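/- Let $n\ge 1$ and let $\Sigma\subset\mathbb{R}^n$ be a compact hypersurface, in the generality of geometric measure theory: a compact set with $\mathcal{H}^{n-1}(\Sigma)<\infty$ that is $(n-1)$-rectifiable, i.e. covered up to an $\mathcal{H}^{n-1}$-null set by countably many Lipschitz images of $\mathbb{R}^{n-1}$. (For example, $\Sigma=\partial K$ for an $n$-dimensional compact submanifold $K\subset\mathbb{R}^n$ with rectifiable boundary.) Here $\mathcal{H}^{n-1}$ is the Hausdorff measure normalized to agree with Lebesgue measure on $\mathbb{R}^{n-1}$, and it serves as the area element $d\Sigma_q$. A unit vector $w$ is called a unit normal of $\Sigma$ at $q$ if $w^\perp$ is the approximate tangent plane of $\Sigma$ at $q$, i.e. if $$\limsup_{r\downarrow 0} r^{-(n-1)}\mathcal{H}^{n-1}\big(\Sigma\cap \bar B(q,r)\big)>0$$ and, for every $s>0$, $$\lim_{r\downarrow 0} r^{-(n-1)}\mathcal{H}^{n-1}\big(\{x\in \Sigma\cap \bar B(q,r): |\langle x-q,w\rangle|> s|x-q|\}\big)=0 .$$ Then at $\mathcal{H}^{n-1}$-almost every $q\in\Sigma$ there is a unit normal $\tilde n(q)$,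 unique up to sign. Let $v\in\mathbb{S}^{n-1}$ be a unit vector with orthogonal complement $v^\perp$, and define the weighted projected area of $\Sigma$ along $v$ by $$\mathcal{V}_{n-1}(\Sigma|v^\perp)=\frac12\int_{\Sigma}|v\cdot\tilde n(q)|\,d\Sigma_q .$$ Both the integrand $q\mapsto|v\cdot\tilde n(q)|$ on $\Sigma$ and the function $u\mapsto \#(\ell_u\cap\Sigma)$ on $v^\perp$ are measurable with respect to the completed measures, and $$\mathcal{V}_{n-1}(\Sigma|v^\perp)=\frac12\int_{v^\perp}\#(\ell_u\cap\Sigma)\,du ,$$ where, for $u\in v^\perp$, $\ell_u$ is the line through $u$ parallel to $v$, $\#(\ell_u\cap\Sigma)\in\{0,1,2,\dots,\infty\}$ is the number of its intersection points with $\Sigma$, and $du$ is the $(n-1)$-dimensional Lebesgue measure (area element) of $v^\perp$. -/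

import Mathlib

open MeasureTheory Filter Topology
open scoped ENNReal NNReal

/-- A compact hypersurface of `ℝⁿ`, in the generality of geometric measure theory: a compact set of
finite `(n-1)`-dimensional (Euclidean-normalized) Hausdorff measure which is
`(n-1)`-rectifiable, i.e. covered, up to an `ℋⁿ⁻¹`-null set, by countably many Lipschitz images of
`ℝⁿ⁻¹`. -/
structure IsCompactHypersurface {n : ℕ} (S : Set (EuclideanSpace ℝ (Fin n))) : Prop where
  isCompact : IsCompact S
  measure_lt_top : μHE[n - 1] S < ∞
  rectifiable : ∃ f : ℕ → EuclideanSpace ℝ (Fin (n - 1)) → EuclideanSpace ℝ (Fin n),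
    (∀ i, ∃ K : ℝ≥0, LipschitzWith K (f i)) ∧ μHE[n - 1] (S \ ⋃ i, Set.range (f i)) = 0

/-- `w` is a unit normal of `S` at `q`: the hyperplane `w^⊥` is the (approximate) tangent plane of
`S` at `q`. That is, `S` has positive upper `(n-1)`-density at `q`, and for every aperture `s > 0`
the part of `S` near `q` lying outside the cone of aperture `s` around `q + w^⊥` has
`(n-1)`-density zero at `q`. -/
def IsUnitNormalAt {n : ℕ} (S : Set (EuclideanSpace ℝ (Fin n)))
    (q w : EuclideanSpace ℝ (Fin n)) : Prop :=
  ‖w‖ = 1 ∧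
  ¬ Tendsto (fun r : ℝ => μHE[n - 1] (S ∩ Metric.closedBall q r) / ENNReal.ofReal (r ^ (n - 1)))
      (𝓝[>] 0) (𝓝 0) ∧
  ∀ s : ℝ, 0 < s →
    Tendsto (fun r : ℝ =>
        μHE[n - 1] (S ∩ Metric.closedBall q r ∩ {x | s * ‖x - q‖ < |inner ℝ (x - q) w|}) /
          ENNReal.ofReal (r ^ (n - 1)))
      (𝓝[>] 0) (𝓝 0)

open scoped Classical in
/-- A unit normal of `S` at `q` (the sign is irrelevant below), or `0` where there is none. -/
noncomputable def unitNormal {n : ℕ} (S : Set (EuclideanSpace ℝ (Fin n)))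
    (q : EuclideanSpace ℝ (Fin n)) : EuclideanSpace ℝ (Fin n) :=
  if h : ∃ w, IsUnitNormalAt S q w then h.choose else 0

/-- The weighted projected area of `S` along `v` onto the subspace `v^⊥`: one half of the integral
over `S` of `|⟨v, ν(q)⟩|` against the area element of `S`. -/
noncomputable def weightedProjectedArea {n : ℕ} (S : Set (EuclideanSpace ℝ (Fin n)))
    (v : EuclideanSpace ℝ (Fin n)) : ℝ≥0∞ :=
  (1 / 2) * ∫⁻ q in S, ENNReal.ofReal |inner ℝ v (unitNormal S q)| ∂μHE[n - 1]

/-- The number (possibly `∞`) of points of `S` on the line through `u` parallel to `v`. -/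
noncomputable def lineCount {n : ℕ} (S : Set (EuclideanSpace ℝ (Fin n)))
    (v u : EuclideanSpace ℝ (Fin n)) : ℝ≥0∞ :=
  (((AffineSubspace.mk' u (ℝ ∙ v) : Set (EuclideanSpace ℝ (Fin n))) ∩ S).encard : ℝ≥0∞)

/-! This is the area formula for the projection along `v`, proved by comparison with flat pieces. By
Rademacher's theorem and a Sard lemma, `S` is up to a null set a countable disjoint union of
measurable pieces whose chords are almost orthogonal to a fixed unit vector `w`, with as small an
aperture as desired (`exists_isNearHyperplanePartition`). Projection to `v^⊥` multiplies the area of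
such a piece by about `|⟨v, w⟩|`, the Jacobian between the two hyperplanes
(`exists_volume_image_estimate`).

The density theorems show that at almost every point of a piece the approximate normal of `S` exists
and is close to `±w` (`exists_isUnitNormalAt`, `IsTangentPieceAt.abs_abs_inner_sub_le`). Hence `|⟨v,
w⟩|` may be replaced by `|⟨v, ν⟩|`. Summing over pieces and letting the error tend to zero gives the
exact formula on any subset where the projection is injective
(`lintegral_eq_volume_chartProj_image`).

Finally, `S` splits into countably many such graphs and a rest where `ν ⊥ v`, whose projection is
null (`IsCompactHypersurface.exists_graph_partition`). The number of points over `y` is then almost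
everywhere the sum of the indicators of the projected graphs. -/

theorem LipschitzOnWith.euclideanHausdorffMeasure_image_le {X Y : Type*} [EMetricSpace X]
    [EMetricSpace Y] [MeasurableSpace X] [BorelSpace X] [MeasurableSpace Y] [BorelSpace Y]
    {K : ℝ≥0} {f : X → Y} {s : Set X} (h : LipschitzOnWith K f s) (d : ℕ) :
    (μHE[d] : Measure Y) (f '' s) ≤ (K : ℝ≥0∞) ^ d * (μHE[d] : Measure X) s := by
  have := h.hausdorffMeasure_image_le (d := d) (Nat.cast_nonneg d)
  rw [ENNReal.rpow_natCast] at this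
  simp only [Measure.euclideanHausdorffMeasure_def, Measure.smul_apply, ENNReal.smul_def,
    smul_eq_mul]
  calc _ ≤ _ * ((K : ℝ≥0∞) ^ d * μH[d] s) := by gcongr
    _ = _ := by ring

/-! ### Charts of hyperplanes and the Jacobian between two of them. -/

/-- `ι` is a linear isometry of `ℝᵐ` onto the hyperplane orthogonal to the unit vector `w`. -/
structure IsHyperplaneChart {E : Type*} [NormedAddCommGroup E] [InnerProductSpace ℝ E] {m : ℕ}
    (ι : EuclideanSpace ℝ (Fin m) →ₗᵢ[ℝ] E) (w : E) : Prop where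
  norm_eq : ‖w‖ = 1
  orth : ∀ y, inner ℝ w (ι y) = 0
  surj : ∀ x, inner ℝ w x = 0 → ∃ y, ι y = x

/-- The adjoint of a linear isometry, i.e. the orthogonal projection onto its range. -/
noncomputable def chartProj {E : Type*} [NormedAddCommGroup E] [InnerProductSpace ℝ E]
    [FiniteDimensional ℝ E] {m : ℕ} (ι : EuclideanSpace ℝ (Fin m) →ₗᵢ[ℝ] E) :
    E →L[ℝ] EuclideanSpace ℝ (Fin m) :=
  haveI := FiniteDimensional.complete ℝ E
  ContinuousLinearMap.adjoint ι.toContinuousLinearMap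

section Chart

variable {E : Type*} [NormedAddCommGroup E] [InnerProductSpace ℝ E] [FiniteDimensional ℝ E] {m : ℕ}
  {ι : EuclideanSpace ℝ (Fin m) →ₗᵢ[ℝ] E} {w : E}

theorem inner_chartProj (ι : EuclideanSpace ℝ (Fin m) →ₗᵢ[ℝ] E) (x : E)
    (y : EuclideanSpace ℝ (Fin m)) :
    inner ℝ (chartProj ι x) y = inner ℝ x (ι y) := by
  have := FiniteDimensional.complete ℝ E
  exact ContinuousLinearMap.adjoint_inner_left _ _ _

theorem chartProj_apply_self (ι : EuclideanSpace ℝ (Fin m) →ₗᵢ[ℝ] E)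
    (y : EuclideanSpace ℝ (Fin m)) : chartProj ι (ι y) = y := by
  refine ext_inner_right ℝ fun z => ?_
  rw [inner_chartProj, ι.inner_map_map]

omit [FiniteDimensional ℝ E] in
theorem IsHyperplaneChart.inner_self (h : IsHyperplaneChart ι w) : inner ℝ w w = (1 : ℝ) := by
  rw [real_inner_self_eq_norm_sq, h.norm_eq, one_pow]

theorem IsHyperplaneChart.chartProj_normal (h : IsHyperplaneChart ι w) : chartProj ι w = 0 := by
  refine ext_inner_right ℝ fun z => ?_
  rw [inner_chartProj, h.orth, inner_zero_left]

theorem IsHyperplaneChart.decomp (h : IsHyperplaneChart ι w) (x : E) :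
    ι (chartProj ι x) + (inner ℝ w x : ℝ) • w = x := by
  obtain ⟨y, hy⟩ := h.surj (x - (inner ℝ w x : ℝ) • w) (by
    rw [inner_sub_right, inner_smul_right, h.inner_self]; ring)
  have hx : x = ι y + (inner ℝ w x : ℝ) • w := by rw [hy]; abel
  have : chartProj ι x = y := by
    rw [hx, map_add, map_smul, h.chartProj_normal, chartProj_apply_self, smul_zero, add_zero]
  rw [this, hy]; abel

theorem norm_chartProj_le (ι : EuclideanSpace ℝ (Fin m) →ₗᵢ[ℝ] E) (x : E) :
    ‖chartProj ι x‖ ≤ ‖x‖ := by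
  by_cases h0 : ‖chartProj ι x‖ = 0
  · rw [h0]; exact norm_nonneg _
  · have h1 : ‖chartProj ι x‖ * ‖chartProj ι x‖ ≤ ‖x‖ * ‖chartProj ι x‖ := by
      calc ‖chartProj ι x‖ * ‖chartProj ι x‖
          = inner ℝ (chartProj ι x) (chartProj ι x) := by rw [real_inner_self_eq_norm_mul_norm]
        _ = inner ℝ x (ι (chartProj ι x)) := inner_chartProj _ _ _
        _ ≤ ‖x‖ * ‖ι (chartProj ι x)‖ := real_inner_le_norm _ _
        _ = _ := by rw [ι.norm_map]
    exact le_of_mul_le_mul_right h1 (lt_of_le_of_ne (norm_nonneg _) (Ne.symm h0))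

theorem lipschitzWith_chartProj (ι : EuclideanSpace ℝ (Fin m) →ₗᵢ[ℝ] E) :
    LipschitzWith 1 (chartProj ι) :=
  LipschitzWith.of_dist_le_mul fun x y => by
    rw [dist_eq_norm, dist_eq_norm, ← map_sub, NNReal.coe_one, one_mul]
    exact norm_chartProj_le _ _

theorem volume_chartProj_image_le [MeasurableSpace E] [BorelSpace E]
    (ι : EuclideanSpace ℝ (Fin m) →ₗᵢ[ℝ] E) (s : Set E) :
    volume (chartProj ι '' s) ≤ (μHE[m] : Measure E) s := by
  have := ((lipschitzWith_chartProj ι).lipschitzOnWith (s := s)).euclideanHausdorffMeasure_image_le m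
  rwa [ENNReal.coe_one, one_pow, one_mul, EuclideanSpace.euclideanHausdorffMeasure_eq_volume] at this

omit [FiniteDimensional ℝ E] in
theorem exists_isHyperplaneChart (hE : Module.finrank ℝ E = m + 1) {w : E} (hw : ‖w‖ = 1) :
    ∃ e : EuclideanSpace ℝ (Fin m) ≃ₗᵢ[ℝ] (ℝ ∙ w)ᗮ,
      IsHyperplaneChart ((ℝ ∙ w)ᗮ.subtypeₗᵢ.comp e.toLinearIsometry) w := by
  have : Fact (Module.finrank ℝ E = m + 1) := ⟨hE⟩
  have hw0 : w ≠ 0 := by rintro rfl; simp at hw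
  refine ⟨(OrthonormalBasis.fromOrthogonalSpanSingleton (𝕜 := ℝ) m hw0).repr.symm, hw, ?_, ?_⟩
  · intro y
    exact Submodule.mem_orthogonal_singleton_iff_inner_right.1 (Subtype.prop _)
  · intro x hx
    refine ⟨(OrthonormalBasis.fromOrthogonalSpanSingleton (𝕜 := ℝ) m hw0).repr
      ⟨x, Submodule.mem_orthogonal_singleton_iff_inner_right.2 hx⟩, ?_⟩
    simp

/-- The Jacobian of the projection between two hyperplanes. -/
theorem abs_det_chartProj_comp {ι' : EuclideanSpace ℝ (Fin m) →ₗᵢ[ℝ] E} {v : E}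
    (h : IsHyperplaneChart ι w) (h' : IsHyperplaneChart ι' v) :
    |((chartProj ι').comp ι.toContinuousLinearMap).det| = |inner ℝ v w| := by
  set A : EuclideanSpace ℝ (Fin m) →ₗ[ℝ] EuclideanSpace ℝ (Fin m) :=
    ((chartProj ι').comp ι.toContinuousLinearMap).toLinearMap with hA
  have hAx : ∀ x, A x = chartProj ι' (ι x) := fun x => rfl
  -- With `p` the projection of `v`, `A* A` is the identity minus `p pᵀ`. This is a transvection of
  -- determinant `1 - ‖p‖² = ⟨v, w⟩²`.
  have key : LinearMap.adjoint A * A =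
      LinearMap.transvection (-(innerSL ℝ (chartProj ι v)) : _ →L[ℝ] ℝ).toLinearMap
        (chartProj ι v) := by
    refine LinearMap.ext fun x => ext_inner_right ℝ fun z => ?_
    rw [Module.End.mul_apply, LinearMap.adjoint_inner_left, hAx, hAx, inner_chartProj]
    have h1 : ι' (chartProj ι' (ι z)) = ι z - (inner ℝ v (ι z) : ℝ) • v := by
      rw [eq_sub_iff_add_eq]; exact h'.decomp _
    rw [h1, LinearMap.transvection.apply, inner_sub_right, inner_add_left, ι.inner_map_map,
      inner_smul_right, inner_smul_left]
    simp only [ContinuousLinearMap.coe_coe, neg_apply, innerSL_apply_apply,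
      inner_chartProj, real_inner_comm v]
    simp
    ring
  have hdet : LinearMap.det A ^ 2 = (inner ℝ v w : ℝ) ^ 2 := by
    have h2 := congrArg LinearMap.det key
    have hadj : LinearMap.det (LinearMap.adjoint A) = LinearMap.det A := by
      have b := stdOrthonormalBasis ℝ (EuclideanSpace ℝ (Fin m))
      rw [← LinearMap.det_toMatrix b.toBasis, ← LinearMap.det_toMatrix b.toBasis A,
        LinearMap.toMatrix_adjoint, Matrix.det_conjTranspose, star_trivial]
    rw [map_mul, hadj, LinearMap.transvection.det] at h2
    have h3 : inner ℝ (chartProj ι v) (chartProj ι v) = 1 - (inner ℝ v w : ℝ) ^ 2 := by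
      have h4 : ι (chartProj ι v) = v - (inner ℝ w v : ℝ) • w := by
        rw [eq_sub_iff_add_eq]; exact h.decomp _
      rw [inner_chartProj, h4, inner_sub_right, inner_smul_right, h'.inner_self,
        real_inner_comm v w]
      ring
    have h5 : (-(innerSL ℝ (chartProj ι v)) : _ →L[ℝ] ℝ).toLinearMap (chartProj ι v) =
        -(1 - (inner ℝ v w : ℝ) ^ 2) := by
      rw [← h3]; rfl
    rw [h5] at h2
    simp at h2
    rw [sq, h2]
  exact (sq_eq_sq_iff_abs_eq_abs _ _).1 hdet

end Chart

theorem ENNReal.le_of_forall_le_add_mul {a b V : ℝ≥0∞} (hV : V ≠ ∞)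
    (h : ∀ η : ℝ≥0, 0 < η → a ≤ b + η * V) : a ≤ b := by
  refine ENNReal.le_of_forall_pos_le_add fun ε hε _ => ?_
  lift V to ℝ≥0 using hV
  refine (h (ε / (V + 1)) (by positivity)).trans ?_
  gcongr
  rw [← ENNReal.coe_mul, ENNReal.coe_le_coe, div_mul_eq_mul_div, div_le_iff₀ (by positivity)]
  gcongr
  exact le_self_add

/-- On `s` the map `f` factors through `g`: composed with any right inverse of `g` it is
`K`-Lipschitz on `g '' s`, and points with equal `g` have equal `f`. -/
theorem euclideanHausdorffMeasure_image_le_of_dist_le {X Y Z : Type*} [MetricSpace X]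
    [MetricSpace Y] [MeasurableSpace X] [BorelSpace X] [MeasurableSpace Y] [BorelSpace Y]
    {K : ℝ≥0} {f : Z → Y} {g : Z → X} {s : Set Z}
    (h : ∀ x ∈ s, ∀ y ∈ s, dist (f x) (f y) ≤ K * dist (g x) (g y)) (d : ℕ) :
    (μHE[d] : Measure Y) (f '' s) ≤ (K : ℝ≥0∞) ^ d * (μHE[d] : Measure X) (g '' s) := by
  rcases s.eq_empty_or_nonempty with rfl | ⟨z₀, hz₀⟩
  · simp
  have : Nonempty Z := ⟨z₀⟩
  have hinv : ∀ x ∈ s, Function.invFunOn g s (g x) ∈ s ∧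
      g (Function.invFunOn g s (g x)) = g x := fun x hx =>
    ⟨Function.invFunOn_mem ⟨x, hx, rfl⟩, Function.invFunOn_eq ⟨x, hx, rfl⟩⟩
  have hlip : LipschitzOnWith K (f ∘ Function.invFunOn g s) (g '' s) := by
    refine LipschitzOnWith.of_dist_le_mul ?_
    rintro _ ⟨x, hx, rfl⟩ _ ⟨y, hy, rfl⟩
    refine (h _ (hinv x hx).1 _ (hinv y hy).1).trans_eq ?_
    rw [(hinv x hx).2, (hinv y hy).2]
  have himg : f '' s ⊆ (f ∘ Function.invFunOn g s) '' (g '' s) := by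
    rintro _ ⟨x, hx, rfl⟩
    refine ⟨g x, ⟨x, hx, rfl⟩, dist_le_zero.1 ?_⟩
    refine (h _ (hinv x hx).1 _ hx).trans_eq ?_
    rw [(hinv x hx).2, dist_self, mul_zero]
  exact (measure_mono himg).trans (hlip.euclideanHausdorffMeasure_image_le d)

/-! ### Sard's lemma for Hausdorff measure. -/

section Sard

variable {E : Type*} [NormedAddCommGroup E] [InnerProductSpace ℝ E]
  [MeasurableSpace E] [BorelSpace E] {m : ℕ}

/-- Let `D` compress the direction `e` by the factor `δ`. Then `A ∘ D = A` and `δ‖z‖ ≤ ‖D z‖`, so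
distances under `f` are at most `‖A‖ + 1` times those under `D`, while `D` shrinks volume by `δ`. -/
theorem euclideanHausdorffMeasure_image_le_of_approximatesLinearOn
    {f : EuclideanSpace ℝ (Fin m) → E} {A : EuclideanSpace ℝ (Fin m) →L[ℝ] E}
    {e : EuclideanSpace ℝ (Fin m)} (he : e ≠ 0) (hAe : A e = 0) {δ : ℝ≥0} (hδ1 : δ ≤ 1)
    {s : Set (EuclideanSpace ℝ (Fin m))} (hf : ApproximatesLinearOn f A s δ) :
    (μHE[m] : Measure E) (f '' s) ≤ ((‖A‖₊ + 1 : ℝ≥0) : ℝ≥0∞) ^ m * (δ * volume s) := by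
  wlog he1 : ‖e‖ = 1 generalizing e
  · refine this (e := ‖e‖⁻¹ • e) ?_ ?_ ?_
    · simpa using he
    · rw [map_smul, hAe, smul_zero]
    · rw [norm_smul, norm_inv, norm_norm, inv_mul_cancel₀ (norm_ne_zero_iff.2 he)]
  set D : EuclideanSpace ℝ (Fin m) →ₗ[ℝ] EuclideanSpace ℝ (Fin m) :=
    LinearMap.transvection (innerSL ℝ e).toLinearMap ((-(1 - δ) : ℝ) • e) with hD
  have hDz : ∀ z, D z = z - ((1 - δ) * inner ℝ e z : ℝ) • e := fun z => by
    rw [hD, LinearMap.transvection.apply, smul_smul]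
    simp only [ContinuousLinearMap.coe_coe, innerSL_apply_apply]
    module
  have hee : inner ℝ e e = (1 : ℝ) := by rw [real_inner_self_eq_norm_sq, he1, one_pow]
  have hdet : LinearMap.det D = δ := by
    rw [hD, LinearMap.transvection.det]
    simp [he1]
  have hδ1' : (δ : ℝ) ≤ 1 := by exact_mod_cast hδ1
  have hδ0 : (0 : ℝ) ≤ δ := δ.2
  have hlow : ∀ z, δ * ‖z‖ ≤ ‖D z‖ := fun z => by
    have h1 : inner ℝ e (D z) = δ * (inner ℝ e z : ℝ) := by
      rw [hDz, inner_sub_right, inner_smul_right, hee]; ring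
    have h2 : ‖z‖ ≤ ‖D z‖ + (1 - δ) * |inner ℝ e z| := by
      calc ‖z‖ = ‖D z + ((1 - δ) * inner ℝ e z : ℝ) • e‖ := by rw [hDz, sub_add_cancel]
        _ ≤ _ := norm_add_le _ _
        _ = _ := by rw [norm_smul, he1, mul_one, Real.norm_eq_abs, abs_mul,
                      abs_of_nonneg (sub_nonneg.2 hδ1')]
    have h3 : δ * |inner ℝ e z| ≤ ‖D z‖ := by
      calc (δ : ℝ) * |inner ℝ e z| = |inner ℝ e (D z)| := by rw [h1, abs_mul, abs_of_nonneg hδ0]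
        _ ≤ ‖e‖ * ‖D z‖ := abs_real_inner_le_norm _ _
        _ = _ := by rw [he1, one_mul]
    calc δ * ‖z‖ ≤ δ * (‖D z‖ + (1 - δ) * |inner ℝ e z|) := by gcongr
      _ = δ * ‖D z‖ + (1 - δ) * (δ * |inner ℝ e z|) := by ring
      _ ≤ δ * ‖D z‖ + (1 - δ) * ‖D z‖ := by
          gcongr
      _ = _ := by ring
  have hAD : ∀ z, A (D z) = A z := fun z => by
    rw [hDz, map_sub, map_smul, hAe, smul_zero, sub_zero]
  have key : ∀ x ∈ s, ∀ y ∈ s, dist (f x) (f y) ≤ (‖A‖₊ + 1 : ℝ≥0) * dist (D x) (D y) := by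
    intro x hx y hy
    rw [dist_eq_norm, dist_eq_norm, ← map_sub]
    calc ‖f x - f y‖ = ‖(f x - f y - A (x - y)) + A (D (x - y))‖ := by rw [hAD, sub_add_cancel]
      _ ≤ ‖f x - f y - A (x - y)‖ + ‖A (D (x - y))‖ := norm_add_le _ _
      _ ≤ δ * ‖x - y‖ + ‖A‖ * ‖D (x - y)‖ := add_le_add (hf x hx y hy) (A.le_opNorm _)
      _ ≤ ‖D (x - y)‖ + ‖A‖ * ‖D (x - y)‖ := by gcongr; exact hlow _
      _ = _ := by push_cast; ring
  refine (euclideanHausdorffMeasure_image_le_of_dist_le key m).trans_eq ?_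
  rw [EuclideanSpace.euclideanHausdorffMeasure_eq_volume, Measure.addHaar_image_linearMap, hdet,
    abs_of_nonneg hδ0, ENNReal.ofReal_coe_nnreal]

/-- A version of **Sard's lemma**: the image of the set where the derivative of a map from `ℝᵐ` is
not injective has zero `m`-dimensional Hausdorff measure. -/
theorem euclideanHausdorffMeasure_image_eq_zero_of_fderiv_not_injective [FiniteDimensional ℝ E]
    {f : EuclideanSpace ℝ (Fin m) → E}
    {f' : EuclideanSpace ℝ (Fin m) → EuclideanSpace ℝ (Fin m) →L[ℝ] E}
    {Z : Set (EuclideanSpace ℝ (Fin m))} (hf : ∀ x ∈ Z, HasFDerivAt f (f' x) x)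
    (hf' : ∀ x ∈ Z, ¬ Function.Injective (f' x)) :
    (μHE[m] : Measure E) (f '' Z) = 0 := by
  suffices H : ∀ N : ℕ, (μHE[m] : Measure E) (f '' (Z ∩ Metric.closedBall 0 N)) = 0 by
    refine measure_mono_null ?_ (measure_iUnion_null H)
    rw [← Set.image_iUnion, ← Set.inter_iUnion, Metric.iUnion_closedBall_nat, Set.inter_univ]
  intro N
  set Z' := Z ∩ Metric.closedBall 0 N
  rcases Z'.eq_empty_or_nonempty with h0 | hne
  · simp [h0]
  refine nonpos_iff_eq_zero.1 (ENNReal.le_of_forall_le_add_mul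
    (V := volume (Metric.closedBall (0 : EuclideanSpace ℝ (Fin m)) N))
    measure_closedBall_lt_top.ne fun η hη => ?_)
  rw [zero_add]
  -- The tolerance cancels the factor `(‖A‖ + 1) ^ m`, so each cell contributes at most `η` times
  -- its volume.
  obtain ⟨t, A, htd, htm, hZt, hA, hy⟩ := exists_partition_approximatesLinearOn_of_hasFDerivWithinAt
    f Z' f' (fun x hx => (hf x hx.1).hasFDerivWithinAt)
    (fun A => min 1 (η / (‖A‖₊ + 1) ^ m)) (fun A => (lt_min one_pos (by positivity)).ne')
  have hb : ∀ k, (μHE[m] : Measure E) (f '' (Z' ∩ t k)) ≤ η * volume (Metric.closedBall 0 N ∩ t k) := by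
    intro k
    obtain ⟨y, hyZ, hyA⟩ := hy hne k
    have hni := hf' y hyZ.1
    rw [← hyA, injective_iff_map_eq_zero] at hni
    push Not at hni
    obtain ⟨e, hAe, he⟩ := hni
    refine (euclideanHausdorffMeasure_image_le_of_approximatesLinearOn he hAe (min_le_left _ _)
      (hA k)).trans ?_
    rw [← mul_assoc]
    refine mul_le_mul' ?_ (measure_mono (Set.inter_subset_inter_left _ Set.inter_subset_right))
    rw [← ENNReal.coe_pow, ← ENNReal.coe_mul, ENNReal.coe_le_coe]
    calc _ ≤ (‖A k‖₊ + 1) ^ m * (η / (‖A k‖₊ + 1) ^ m) := by gcongr; exact min_le_right _ _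
      _ = η := by field_simp
  calc (μHE[m] : Measure E) (f '' Z')
      ≤ (μHE[m] : Measure E) (⋃ k, f '' (Z' ∩ t k)) := by
        refine measure_mono ?_
        rw [← Set.image_iUnion, ← Set.inter_iUnion, Set.inter_eq_left.2 hZt]
    _ ≤ ∑' k, (μHE[m] : Measure E) (f '' (Z' ∩ t k)) := measure_iUnion_le _
    _ ≤ ∑' k, η * volume (Metric.closedBall 0 N ∩ t k) := ENNReal.tsum_le_tsum hb
    _ = η * volume (⋃ k, Metric.closedBall 0 N ∩ t k) := by
        rw [ENNReal.tsum_mul_left, measure_iUnion]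
        · exact fun i j hij => (htd hij).mono Set.inter_subset_right Set.inter_subset_right
        · exact fun k => measurableSet_closedBall.inter (htm k)
    _ ≤ _ := by
        gcongr
        exact Set.iUnion_subset fun k => Set.inter_subset_left

end Sard

/-- All the chords of `T` make a small angle with the hyperplane orthogonal to `w`. -/
def NearHyperplane {E : Type*} [NormedAddCommGroup E] [InnerProductSpace ℝ E] (T : Set E) (w : E)
    (ε : ℝ) : Prop :=
  ∀ x ∈ T, ∀ y ∈ T, |(inner ℝ w (x - y) : ℝ)| ≤ ε * ‖x - y‖

/-! ### Decomposition of rectifiable sets into nearly flat pieces. -/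

section Decomposition

variable {E : Type*} [NormedAddCommGroup E] [InnerProductSpace ℝ E] {m : ℕ} {T T' : Set E} {w : E}
  {ε ε' : ℝ}

theorem NearHyperplane.mono (h : NearHyperplane T w ε) (hT : T' ⊆ T) : NearHyperplane T' w ε :=
  fun x hx y hy => h x (hT hx) y (hT hy)

theorem NearHyperplane.mono_right (h : NearHyperplane T w ε) (hε : ε ≤ ε') :
    NearHyperplane T w ε' :=
  fun x hx y hy => (h x hx y hy).trans (by gcongr)

theorem NearHyperplane.closure (h : NearHyperplane T w ε) : NearHyperplane (closure T) w ε := by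
  have hc : IsClosed {p : E × E | |(inner ℝ w (p.1 - p.2) : ℝ)| ≤ ε * ‖p.1 - p.2‖} :=
    isClosed_le (by fun_prop) (by fun_prop)
  have hsub : T ×ˢ T ⊆ {p : E × E | |(inner ℝ w (p.1 - p.2) : ℝ)| ≤ ε * ‖p.1 - p.2‖} :=
    fun p hp => h p.1 hp.1 p.2 hp.2
  have := hc.closure_subset_iff.2 hsub
  rw [closure_prod_eq] at this
  exact fun x hx y hy => this (Set.mk_mem_prod hx hy)

/-- An injective `A` is bounded below, so the linearization error `δ‖x - y‖` is small relative to
`‖f x - f y‖`. Injectivity is assumed only after `δ` because the covering theorem needs a tolerance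
for every `A`. -/
theorem exists_nearHyperplane_image_of_approximatesLinearOn
    (A : EuclideanSpace ℝ (Fin m) →L[ℝ] E) (hw : ‖w‖ = 1) (hwA : ∀ z, inner ℝ w (A z) = 0)
    (hε : 0 < ε) :
    ∃ δ : ℝ≥0, δ ≠ 0 ∧ (Function.Injective A → ∀ (f : EuclideanSpace ℝ (Fin m) → E)
      (s : Set (EuclideanSpace ℝ (Fin m))), ApproximatesLinearOn f A s δ →
        NearHyperplane (f '' s) w ε) := by
  by_cases hA : Function.Injective A
  swap
  · exact ⟨1, one_ne_zero, fun h => absurd h hA⟩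
  obtain ⟨K, hK, hAK⟩ := A.toLinearMap.exists_antilipschitzWith (LinearMap.ker_eq_bot.2 hA)
  lift ε to ℝ≥0 using hε.le
  have hε' : 0 < ε := hε
  -- Chosen so that `δ (1 + ε) K = ε`; the term `ε δ‖x - y‖` pays for passing from `‖A (x - y)‖` to
  -- `‖f x - f y‖`.
  refine ⟨ε / (K * (1 + ε)), by positivity, fun _ f s hf => ?_⟩
  rintro _ ⟨x, hx, rfl⟩ _ ⟨y, hy, rfl⟩
  have h1 := hf x hx y hy
  have h2 : ‖x - y‖ ≤ K * ‖A (x - y)‖ := by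
    have := hAK.le_mul_dist x y
    rw [dist_eq_norm, dist_eq_norm, ContinuousLinearMap.coe_coe, ← map_sub] at this
    exact this
  set δ : ℝ := ((ε / (K * (1 + ε)) : ℝ≥0) : ℝ) with hδ
  have hδK : δ * (1 + ε) * K = ε := by
    rw [hδ]; push_cast
    have : (K : ℝ) ≠ 0 := by exact_mod_cast hK.ne'
    have : (1 + ε : ℝ) ≠ 0 := by positivity
    field_simp
  have hδ0 : 0 ≤ δ := NNReal.coe_nonneg _
  have h3 : δ * (1 + ε) * ‖x - y‖ ≤ ε * ‖A (x - y)‖ := by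
    calc δ * (1 + ε) * ‖x - y‖ ≤ δ * (1 + ε) * (K * ‖A (x - y)‖) := by gcongr
      _ = _ := by rw [← mul_assoc, hδK]
  have h4 : ‖A (x - y)‖ ≤ ‖f x - f y‖ + δ * ‖x - y‖ := by
    calc ‖A (x - y)‖ = ‖(f x - f y) - (f x - f y - A (x - y))‖ := by rw [sub_sub_cancel]
      _ ≤ _ := (norm_sub_le _ _).trans (by gcongr)
  have h5 : |(inner ℝ w (f x - f y) : ℝ)| ≤ δ * ‖x - y‖ := by
    calc |(inner ℝ w (f x - f y) : ℝ)| = |inner ℝ w (f x - f y - A (x - y))| := by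
          rw [inner_sub_right w (f x - f y), hwA, sub_zero]
      _ ≤ ‖w‖ * ‖f x - f y - A (x - y)‖ := abs_real_inner_le_norm _ _
      _ ≤ _ := by rw [hw, one_mul]; exact h1
  have h6 : (ε : ℝ) * ‖A (x - y)‖ ≤ ε * (‖f x - f y‖ + δ * ‖x - y‖) := by gcongr
  linarith

theorem exists_unit_orthogonal_range (hE : Module.finrank ℝ E = m + 1)
    (A : EuclideanSpace ℝ (Fin m) →L[ℝ] E) :
    ∃ w : E, ‖w‖ = 1 ∧ ∀ z, inner ℝ w (A z) = 0 := by
  have : FiniteDimensional ℝ E := Module.finite_of_finrank_eq_succ hE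
  have hne : (LinearMap.range A.toLinearMap)ᗮ ≠ ⊥ := by
    intro h
    rw [Submodule.orthogonal_eq_bot_iff] at h
    have h1 := LinearMap.finrank_range_le A.toLinearMap
    rw [h, finrank_top, hE, finrank_euclideanSpace_fin] at h1
    omega
  obtain ⟨u, hu, hu0⟩ := Submodule.exists_mem_ne_zero_of_ne_bot hne
  refine ⟨‖u‖⁻¹ • u, ?_, fun z => ?_⟩
  · rw [norm_smul, norm_inv, norm_norm, inv_mul_cancel₀ (norm_ne_zero_iff.2 hu0)]
  · rw [inner_smul_left, (Submodule.mem_orthogonal' _ _).1 hu (A z) ⟨z, rfl⟩, mul_zero]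

variable [MeasurableSpace E] [BorelSpace E]

/-- Points without derivative have null image by Rademacher, those with singular derivative by Sard;
the rest is covered by sets where `f` is almost linear. The aperture depends on the normal because
the later area estimate is not stated uniformly in `w`. Closures make the pieces measurable. -/
theorem exists_nearHyperplane_cover_range (hE : Module.finrank ℝ E = m + 1)
    {f : EuclideanSpace ℝ (Fin m) → E} {K : ℝ≥0} (hf : LipschitzWith K f) {ε : E → ℝ}
    (hε : ∀ w, 0 < ε w) :
    ∃ (T : ℕ → Set E) (w : ℕ → E), (∀ k, IsClosed (T k)) ∧ (∀ k, ‖w k‖ = 1) ∧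
      (∀ k, NearHyperplane (T k) (w k) (ε (w k))) ∧
      (μHE[m] : Measure E) (Set.range f \ ⋃ k, T k) = 0 := by
  have : FiniteDimensional ℝ E := Module.finite_of_finrank_eq_succ hE
  choose W hW1 hW using exists_unit_orthogonal_range (m := m) hE
  choose δ hδ0 hδ using fun A =>
    exists_nearHyperplane_image_of_approximatesLinearOn A (hW1 A) (hW A) (hε (W A))
  set D := {x | DifferentiableAt ℝ f x}
  set D₁ := {x ∈ D | Function.Injective (fderiv ℝ f x)}
  set D₀ := {x ∈ D | ¬ Function.Injective (fderiv ℝ f x)}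
  obtain ⟨t, A, -, hcov, hA, hy⟩ := exists_closed_cover_approximatesLinearOn_of_hasFDerivWithinAt
    f D₁ (fderiv ℝ f) (fun x hx => hx.1.hasFDerivAt.hasFDerivWithinAt) δ hδ0
  refine ⟨fun k => closure (f '' (D₁ ∩ t k)), fun k => W (A k), fun k => isClosed_closure,
    fun k => hW1 _, fun k => ?_, ?_⟩
  · rcases D₁.eq_empty_or_nonempty with h0 | hne
    · rw [h0]
      simp [NearHyperplane]
    · obtain ⟨y, hyD, hyA⟩ := hy hne k
      exact (hδ (A k) (hyA ▸ hyD.2) f _ (hA k)).closure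
  · have h0 : (μHE[m] : Measure E) (f '' D₀) = 0 :=
      euclideanHausdorffMeasure_image_eq_zero_of_fderiv_not_injective
        (fun x hx => hx.1.hasFDerivAt) (fun x hx => hx.2)
    have h1 : (μHE[m] : Measure E) (f '' Dᶜ) = 0 := by
      have h2 : volume Dᶜ = 0 := hf.ae_differentiableAt
      have h3 := (hf.lipschitzOnWith (s := Dᶜ)).euclideanHausdorffMeasure_image_le m
      rw [EuclideanSpace.euclideanHausdorffMeasure_eq_volume, h2, mul_zero] at h3
      exact nonpos_iff_eq_zero.1 h3
    refine measure_mono_null ?_ (measure_union_null h0 h1)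
    rintro _ ⟨⟨x, rfl⟩, hx⟩
    by_cases hxD : x ∈ D
    · refine Or.inl ⟨x, ⟨hxD, fun hinj => hx ?_⟩, rfl⟩
      obtain ⟨k, hk⟩ := Set.mem_iUnion.1 (hcov ⟨hxD, hinj⟩)
      exact Set.mem_iUnion.2 ⟨k, subset_closure ⟨x, ⟨⟨hxD, hinj⟩, hk⟩, rfl⟩⟩
    · exact Or.inr ⟨x, hxD, rfl⟩

/-- A measurable partition, up to a null set, into pieces close to hyperplanes. -/
structure IsNearHyperplanePartition (m : ℕ) (S : Set E) (ε : E → ℝ) (T : ℕ → Set E) (w : ℕ → E) :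
    Prop where
  measurableSet : ∀ k, MeasurableSet (T k)
  disjoint : Pairwise (Function.onFun Disjoint T)
  subset : ∀ k, T k ⊆ S
  norm_eq : ∀ k, ‖w k‖ = 1
  near : ∀ k, NearHyperplane (T k) (w k) (ε (w k))
  null : (μHE[m] : Measure E) (S \ ⋃ k, T k) = 0

theorem exists_isNearHyperplanePartition (hE : Module.finrank ℝ E = m + 1) {S : Set E}
    (hS : MeasurableSet S) (hr : ∃ f : ℕ → EuclideanSpace ℝ (Fin m) → E,
      (∀ i, ∃ K : ℝ≥0, LipschitzWith K (f i)) ∧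
        (μHE[m] : Measure E) (S \ ⋃ i, Set.range (f i)) = 0)
    {ε : E → ℝ} (hε : ∀ w, 0 < ε w) :
    ∃ (T : ℕ → Set E) (w : ℕ → E), IsNearHyperplanePartition m S ε T w := by
  obtain ⟨f, hf, hfS⟩ := hr
  choose K hK using hf
  choose T w hTc hw hT hn using fun i => exists_nearHyperplane_cover_range hE (hK i) hε
  set T' : ℕ → Set E := fun k => S ∩ T k.unpair.1 k.unpair.2 with hT'
  have hTm : ∀ k, MeasurableSet (T' k) := fun k => hS.inter (hTc _ _).measurableSet
  refine ⟨disjointed T', fun k => w k.unpair.1 k.unpair.2,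
    MeasurableSet.disjointed hTm, disjoint_disjointed _,
    fun k => (disjointed_subset _ _).trans Set.inter_subset_left, fun k => hw _ _,
    fun k => (hT _ _).mono ((disjointed_subset _ _).trans Set.inter_subset_right), ?_⟩
  rw [iUnion_disjointed]
  refine measure_mono_null ?_ (measure_union_null hfS (measure_iUnion_null hn))
  rintro x ⟨hxS, hx⟩
  by_cases hxf : x ∈ ⋃ i, Set.range (f i)
  · obtain ⟨i, hi⟩ := Set.mem_iUnion.1 hxf
    refine Or.inr (Set.mem_iUnion.2 ⟨i, hi, fun hxT => hx ?_⟩)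
    obtain ⟨k, hk⟩ := Set.mem_iUnion.1 hxT
    exact Set.mem_iUnion.2 ⟨Nat.pair i k, hxS, by simpa using hk⟩
  · exact Or.inl ⟨hxS, hxf⟩

end Decomposition

/-! ### Density properties of nearly flat pieces. -/

section Density

variable {E : Type*} [NormedAddCommGroup E] [InnerProductSpace ℝ E] [FiniteDimensional ℝ E] {m : ℕ}
  {ι : EuclideanSpace ℝ (Fin m) →ₗᵢ[ℝ] E} {T S : Set E} {w : E} {ε : ℝ}

theorem NearHyperplane.mul_norm_sub_le (h : NearHyperplane T w ε) (hι : IsHyperplaneChart ι w)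
    {x y : E} (hx : x ∈ T) (hy : y ∈ T) :
    (1 - ε) * ‖x - y‖ ≤ ‖chartProj ι (x - y)‖ := by
  have h1 : ‖x - y‖ ≤ ‖chartProj ι (x - y)‖ + |inner ℝ w (x - y)| := by
    calc ‖x - y‖ = ‖ι (chartProj ι (x - y)) + (inner ℝ w (x - y) : ℝ) • w‖ := by rw [hι.decomp]
      _ ≤ _ := norm_add_le _ _
      _ = _ := by rw [ι.norm_map, norm_smul, hι.norm_eq, mul_one, Real.norm_eq_abs]
  have h2 := h x hx y hy
  linarith

theorem NearHyperplane.norm_sub_le (h : NearHyperplane T w ε) (hε : ε ≤ 1 / 2)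
    (hι : IsHyperplaneChart ι w) {x y : E} (hx : x ∈ T) (hy : y ∈ T) :
    ‖x - y‖ ≤ 2 * ‖chartProj ι (x - y)‖ := by
  have := (h.mono_right hε).mul_norm_sub_le hι hx hy
  linarith

variable [MeasurableSpace E] [BorelSpace E]

theorem NearHyperplane.measure_le_mul_volume_image {K : ℝ≥0} (h : NearHyperplane T w ε)
    (hK : 1 ≤ K * (1 - ε)) (hι : IsHyperplaneChart ι w) :
    (μHE[m] : Measure E) T ≤ (K : ℝ≥0∞) ^ m * volume (chartProj ι '' T) := by
  have := euclideanHausdorffMeasure_image_le_of_dist_le (K := K) (f := id) (g := chartProj ι)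
    (s := T) (fun x hx y hy => by
      rw [id, id, dist_eq_norm, dist_eq_norm, ← map_sub]
      calc ‖x - y‖ ≤ (K * (1 - ε)) * ‖x - y‖ := le_mul_of_one_le_left (norm_nonneg _) hK
        _ = K * ((1 - ε) * ‖x - y‖) := by ring
        _ ≤ _ := by gcongr; exact h.mul_norm_sub_le hι hx hy) m
  rwa [Set.image_id, EuclideanSpace.euclideanHausdorffMeasure_eq_volume] at this

theorem NearHyperplane.measure_inter_closedBall_le (h : NearHyperplane T w ε) (hε : ε ≤ 1 / 2)
    (hι : IsHyperplaneChart ι w) (q : E) {r : ℝ} (hr : 0 ≤ r) :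
    (μHE[m] : Measure E) (T ∩ Metric.closedBall q r) ≤
      2 ^ m * volume (Metric.closedBall (0 : EuclideanSpace ℝ (Fin m)) 1) *
        ENNReal.ofReal (r ^ m) := by
  refine (((h.mono Set.inter_subset_left).mono_right hε).measure_le_mul_volume_image (K := 2)
    (by norm_num) hι).trans ?_
  rw [mul_assoc]
  refine mul_le_mul' le_rfl ?_
  have hsub : chartProj ι '' (T ∩ Metric.closedBall q r) ⊆
      Metric.closedBall (chartProj ι q) r := by
    rintro _ ⟨x, hx, rfl⟩
    refine ((lipschitzWith_chartProj ι).dist_le_mul x q).trans ?_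
    rw [NNReal.coe_one, one_mul]
    exact hx.2
  refine (measure_mono hsub).trans_eq ?_
  rw [Measure.addHaar_closedBall' _ _ hr, finrank_euclideanSpace_fin, mul_comm]

/-- Besicovitch's theorem compares `S \ T` only with `S` in small balls, and `S` has no a priori
bound by `r ^ m`. But `T` fills more than half of `S` there, and `T` obeys such a bound since its
projection is bi-Lipschitz. -/
theorem NearHyperplane.ae_tendsto_measure_diff (h : NearHyperplane T w ε) (hε : ε ≤ 1 / 2)
    (hι : IsHyperplaneChart ι w) (hT : MeasurableSet T) (hTS : T ⊆ S)
    (hfin : (μHE[m] : Measure E) S < ∞) :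
    ∀ᵐ q ∂((μHE[m] : Measure E).restrict T),
      Tendsto (fun r : ℝ => (μHE[m] : Measure E) ((S \ T) ∩ Metric.closedBall q r) /
        ENNReal.ofReal (r ^ m)) (𝓝[>] 0) (𝓝 0) := by
  have : IsFiniteMeasure ((μHE[m] : Measure E).restrict S) :=
    ⟨by rwa [Measure.restrict_apply_univ]⟩
  have hd := Besicovitch.ae_tendsto_measure_inter_div ((μHE[m] : Measure E).restrict S) T
  rw [Measure.restrict_restrict hT, Set.inter_eq_left.2 hTS] at hd
  filter_upwards [hd] with q hq
  set a : ℝ → ℝ≥0∞ := fun r => (μHE[m] : Measure E) (T ∩ Metric.closedBall q r) with ha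
  set b : ℝ → ℝ≥0∞ := fun r => (μHE[m] : Measure E) ((S \ T) ∩ Metric.closedBall q r) with hb
  set s : ℝ → ℝ≥0∞ := fun r => (μHE[m] : Measure E) (S ∩ Metric.closedBall q r) with hs
  have hq' : Tendsto (fun r => a r / s r) (𝓝[>] 0) (𝓝 1) := by
    refine hq.congr fun r => ?_
    rw [Measure.restrict_apply (hT.inter measurableSet_closedBall),
      Measure.restrict_apply measurableSet_closedBall, Set.inter_assoc,
      Set.inter_comm (Metric.closedBall q r) S, ← Set.inter_assoc, Set.inter_eq_left.2 hTS]
  have hab : ∀ r, b r + a r = s r := fun r => by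
    have := measure_inter_add_sdiff (μ := (μHE[m] : Measure E)) (S ∩ Metric.closedBall q r) hT
    rw [add_comm] at this
    refine Eq.trans ?_ this
    simp only [ha, hb]
    congr 2
    · ext x; simp only [Set.mem_inter_iff, Set.mem_sdiff]; tauto
    · ext x; simp only [Set.mem_inter_iff]; constructor
      · exact fun hx => ⟨⟨hTS hx.1, hx.2⟩, hx.1⟩
      · exact fun hx => ⟨hx.2, hx.1.2⟩
  have hsfin : ∀ r, s r ≠ ∞ := fun r => (measure_mono Set.inter_subset_left |>.trans_lt hfin).ne
  have hbig : ∀ᶠ r in 𝓝[>] (0 : ℝ), 2⁻¹ < a r / s r :=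
    hq'.eventually (lt_mem_nhds (by simp))
  have hs0 : ∀ r, 2⁻¹ < a r / s r → s r ≠ 0 := fun r hr h0 => by
    have ha0 : a r = 0 := by
      have := hab r
      rw [h0, add_eq_zero] at this
      exact this.2
    simp [ha0] at hr
  have hbs : Tendsto (fun r => b r / s r) (𝓝[>] 0) (𝓝 0) := by
    have h1 : Tendsto (fun r => 1 - a r / s r) (𝓝[>] 0) (𝓝 (1 - 1)) :=
      ENNReal.Tendsto.sub tendsto_const_nhds hq' (Or.inl ENNReal.one_ne_top)
    rw [tsub_self] at h1
    refine h1.congr' ?_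
    filter_upwards [hbig] with r hr
    refine (ENNReal.eq_sub_of_add_eq ?_ ?_).symm
    · exact ENNReal.div_ne_top ((le_add_self.trans_eq (hab r)).trans_lt (hsfin r).lt_top).ne
        (hs0 r hr)
    · rw [← ENNReal.add_div, hab, ENNReal.div_self (hs0 r hr) (hsfin r)]
  set C : ℝ≥0∞ := 2 * (2 ^ m * volume (Metric.closedBall (0 : EuclideanSpace ℝ (Fin m)) 1))
  have hC : C ≠ ∞ := ENNReal.mul_ne_top (by simp)
    (ENNReal.mul_ne_top (by simp) measure_closedBall_lt_top.ne)
  have hlim : Tendsto (fun r => b r / s r * C) (𝓝[>] 0) (𝓝 0) := by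
    have := ENNReal.Tendsto.mul_const hbs (b := C) (Or.inr hC)
    rwa [zero_mul] at this
  refine tendsto_of_tendsto_of_tendsto_of_le_of_le' tendsto_const_nhds hlim
    (Eventually.of_forall fun _ => zero_le) ?_
  filter_upwards [hbig, self_mem_nhdsWithin] with r hr hr0
  have hsC : s r ≤ C * ENNReal.ofReal (r ^ m) := by
    calc s r ≤ 2 * a r := by
          have h3 := (ENNReal.lt_div_iff_mul_lt (Or.inl (hs0 r hr)) (Or.inl (hsfin r))).1 hr
          calc s r = 2 * (2⁻¹ * s r) := by
                rw [← mul_assoc, ENNReal.mul_inv_cancel two_ne_zero (by simp), one_mul]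
            _ ≤ _ := by gcongr
      _ ≤ 2 * (2 ^ m * volume (Metric.closedBall (0 : EuclideanSpace ℝ (Fin m)) 1) *
            ENNReal.ofReal (r ^ m)) := by
          gcongr
          exact h.measure_inter_closedBall_le hε hι q (le_of_lt hr0)
      _ = _ := by rw [← mul_assoc]
  refine ENNReal.div_le_of_le_mul ?_
  calc b r = b r / s r * s r := (ENNReal.div_mul_cancel (hs0 r hr) (hsfin r)).symm
    _ ≤ b r / s r * (C * ENNReal.ofReal (r ^ m)) := by gcongr
    _ = _ := by ring

/-- The projection of `T` to the hyperplane has positive density at the projection of `q` along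
the balls that are homothetic, with center the projection of `q`, to a fixed ball. -/
def HasThickProjAt (ι : EuclideanSpace ℝ (Fin m) →ₗᵢ[ℝ] E) (T : Set E) (q : E) : Prop :=
  ∀ (y : EuclideanSpace ℝ (Fin m)) (ρ : ℝ), 0 < ρ →
    ¬ Tendsto (fun r : ℝ => volume (chartProj ι '' T ∩
      Metric.closedBall (chartProj ι q + r • y) (r * ρ)) / ENNReal.ofReal (r ^ m))
        (𝓝[>] 0) (𝓝 0)

omit [FiniteDimensional ℝ E] [MeasurableSpace E] [BorelSpace E] in
theorem ae_not_tendsto_volume_inter_closedBall (A : Set (EuclideanSpace ℝ (Fin m))) :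
    ∀ᵐ z ∂(volume.restrict A), ∀ (y : EuclideanSpace ℝ (Fin m)) (ρ : ℝ), 0 < ρ →
      ¬ Tendsto (fun r : ℝ => volume (A ∩ Metric.closedBall (z + r • y) (r * ρ)) /
        ENNReal.ofReal (r ^ m)) (𝓝[>] 0) (𝓝 0) := by
  have h := ae_all_iff.2 fun K : ℕ =>
    IsUnifLocDoublingMeasure.ae_tendsto_measure_inter_div.{0, 0}
      (volume : Measure (EuclideanSpace ℝ (Fin m))) A (K : ℝ)
  filter_upwards [h] with z hz y ρ hρ hlim
  -- The point `z` lies within `K` radii of the off-centre ball, so the density theorem for doubling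
  -- measures gives relative density one.
  obtain ⟨K, hK⟩ := exists_nat_ge (‖y‖ / ρ)
  rw [div_le_iff₀ hρ] at hK
  have hδ : Tendsto (fun r : ℝ => r * ρ) (𝓝[>] 0) (𝓝[>] 0) := by
    refine tendsto_nhdsWithin_iff.2 ⟨?_, ?_⟩
    · have : Tendsto (fun r : ℝ => r * ρ) (𝓝 0) (𝓝 (0 * ρ)) := tendsto_id.mul_const ρ
      rw [zero_mul] at this
      exact this.mono_left nhdsWithin_le_nhds
    · filter_upwards [self_mem_nhdsWithin] with r hr
      exact mul_pos hr hρ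
  have h1 := hz K (fun r : ℝ => z + r • y) (fun r => r * ρ) hδ (by
    filter_upwards [self_mem_nhdsWithin] with r hr
    have hr' : (0 : ℝ) < r := hr
    rw [Metric.mem_closedBall, dist_self_add_right, norm_smul, Real.norm_of_nonneg hr'.le]
    calc r * ‖y‖ ≤ r * (K * ρ) := by gcongr
      _ = _ := by ring)
  set V : ℝ≥0∞ := ENNReal.ofReal (ρ ^ m) *
    volume (Metric.closedBall (0 : EuclideanSpace ℝ (Fin m)) 1)
  have hV0 : V ≠ 0 := mul_ne_zero (by simp; positivity)
    (Metric.measure_closedBall_pos _ _ one_pos).ne'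
  have hV : V ≠ ∞ := ENNReal.mul_ne_top ENNReal.ofReal_ne_top measure_closedBall_lt_top.ne
  have h2 := ENNReal.Tendsto.mul_const hlim (b := V⁻¹) (Or.inr (ENNReal.inv_ne_top.2 hV0))
  rw [zero_mul] at h2
  refine zero_ne_one (tendsto_nhds_unique (h2.congr' ?_) h1)
  filter_upwards [self_mem_nhdsWithin] with r hr
  have hr' : (0 : ℝ) < r := hr
  rw [Measure.addHaar_closedBall' _ (z + r • y) (by positivity : 0 ≤ r * ρ),
    finrank_euclideanSpace_fin, mul_pow, ENNReal.ofReal_mul (by positivity), mul_assoc,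
    ENNReal.div_eq_inv_mul, ENNReal.div_eq_inv_mul,
    ENNReal.mul_inv (Or.inr hV) (Or.inr hV0)]
  ring

/-- The exceptional points of the projection form a null set, and the inverse of the projection on
`T` is 2-Lipschitz, hence preserves null sets. -/
theorem NearHyperplane.ae_hasThickProjAt (h : NearHyperplane T w ε) (hε : ε ≤ 1 / 2)
    (hι : IsHyperplaneChart ι w) (hT : MeasurableSet T) :
    ∀ᵐ q ∂((μHE[m] : Measure E).restrict T), HasThickProjAt ι T q := by
  have h1 := ae_not_tendsto_volume_inter_closedBall (chartProj ι '' T)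
  rw [ae_iff] at h1
  rw [ae_restrict_iff' hT, ae_iff]
  set N := {z | ¬ ∀ (y : EuclideanSpace ℝ (Fin m)) (ρ : ℝ), 0 < ρ →
      ¬ Tendsto (fun r : ℝ => volume (chartProj ι '' T ∩ Metric.closedBall (z + r • y) (r * ρ)) /
        ENNReal.ofReal (r ^ m)) (𝓝[>] 0) (𝓝 0)}
  have h2 : volume (N ∩ chartProj ι '' T) = 0 :=
    nonpos_iff_eq_zero.1 ((Measure.le_restrict_apply _ _).trans h1.le)
  have h3 := ((h.mono (Set.inter_subset_left (t := chartProj ι ⁻¹' N))).mono_right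
    hε).measure_le_mul_volume_image (K := 2) (by norm_num) hι
  have h4 : volume (chartProj ι '' (T ∩ chartProj ι ⁻¹' N)) = 0 := by
    refine measure_mono_null ?_ h2
    rintro _ ⟨x, hx, rfl⟩
    exact ⟨hx.2, x, hx.1, rfl⟩
  rw [h4, mul_zero] at h3
  refine measure_mono_null ?_ (nonpos_iff_eq_zero.1 h3)
  intro q hq
  rw [Set.mem_ofPred_eq, Classical.not_imp] at hq
  exact ⟨hq.1, hq.2⟩

end Density

/-! ### Existence, uniqueness and approximation of the unit normal. -/

section Normal

variable {n : ℕ} {S T : Set (EuclideanSpace ℝ (Fin n))} {q v w w₀ : EuclideanSpace ℝ (Fin n)}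
  {ε : ℝ} {ι : EuclideanSpace ℝ (Fin (n - 1)) →ₗᵢ[ℝ] EuclideanSpace ℝ (Fin n)}

/-- `T` is a piece of `S` close to the hyperplane orthogonal to `w₀`, it fills `S` at `q` in the
sense of density, and its projection to the hyperplane is thick. -/
structure IsTangentPieceAt (S T : Set (EuclideanSpace ℝ (Fin n)))
    (ι : EuclideanSpace ℝ (Fin (n - 1)) →ₗᵢ[ℝ] EuclideanSpace ℝ (Fin n))
    (w₀ : EuclideanSpace ℝ (Fin n)) (ε : ℝ) (q : EuclideanSpace ℝ (Fin n)) : Prop where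
  chart : IsHyperplaneChart ι w₀
  near : NearHyperplane T w₀ ε
  subset : T ⊆ S
  mem : q ∈ T
  thick : HasThickProjAt ι T q
  diff : Tendsto (fun r : ℝ => (μHE[n - 1] : Measure (EuclideanSpace ℝ (Fin n)))
    ((S \ T) ∩ Metric.closedBall q r) / ENNReal.ofReal (r ^ (n - 1))) (𝓝[>] 0) (𝓝 0)

theorem NearHyperplane.ae_isTangentPieceAt (h : NearHyperplane T w₀ ε) (hε : ε ≤ 1 / 2)
    (hι : IsHyperplaneChart ι w₀) (hT : MeasurableSet T) (hTS : T ⊆ S)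
    (hfin : (μHE[n - 1] : Measure (EuclideanSpace ℝ (Fin n))) S < ∞) :
    ∀ᵐ q ∂((μHE[n - 1] : Measure (EuclideanSpace ℝ (Fin n))).restrict T),
      IsTangentPieceAt S T ι w₀ ε q := by
  filter_upwards [h.ae_tendsto_measure_diff hε hι hT hTS hfin, h.ae_hasThickProjAt hε hι hT,
    ae_restrict_mem hT] with q h1 h2 h3
  exact ⟨hι, h, hTS, h3, h2, h1⟩

/-- To bound the volume of the projection of `T` in a small ball, it is enough that `T` is, over
this ball, contained in a set of zero density. -/
theorem HasThickProjAt.not_tendsto (h : HasThickProjAt ι T q) {y : EuclideanSpace ℝ (Fin (n - 1))}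
    {ρ : ℝ} (hρ : 0 < ρ) {B : ℝ → Set (EuclideanSpace ℝ (Fin n))}
    (hB : ∀ r, 0 < r → ∀ x ∈ T, ‖chartProj ι (x - q) - r • y‖ ≤ r * ρ → x ∈ B r) :
    ¬ Tendsto (fun r : ℝ => (μHE[n - 1] : Measure (EuclideanSpace ℝ (Fin n))) (B r) /
      ENNReal.ofReal (r ^ (n - 1))) (𝓝[>] 0) (𝓝 0) := by
  intro hlim
  refine h y ρ hρ (tendsto_of_tendsto_of_tendsto_of_le_of_le' tendsto_const_nhds hlim
    (Eventually.of_forall fun _ => zero_le) ?_)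
  filter_upwards [self_mem_nhdsWithin] with r hr
  refine ENNReal.div_le_div_right ((measure_mono ?_).trans (volume_chartProj_image_le ι (B r))) _
  rintro _ ⟨⟨x, hx, rfl⟩, hxr⟩
  refine ⟨x, hB r hr x hx ?_, rfl⟩
  rw [Metric.mem_closedBall, dist_eq_norm] at hxr
  rwa [map_sub, sub_sub]

/-- If `w` were tilted further from `w₀`, the points of `T` lying over a small ball displaced in the
direction of the tilt would leave the cone around `w^⊥`. Thickness of the projection makes them too
many for a unit normal `w`. -/
theorem IsTangentPieceAt.norm_chartProj_le (h : IsTangentPieceAt S T ι w₀ ε q) (hε0 : 0 < ε)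
    (hε : ε ≤ 1 / 2) (hw : IsUnitNormalAt S q w) : ‖chartProj ι w‖ ≤ 4 * ε := by
  by_contra! hlt
  set a := ‖chartProj ι w‖ with ha
  have ha0 : 0 < a := by linarith
  -- The final inequality `5 s / 8 < 3 a / 16 - 5 ε / 8` is then equivalent to `4 ε < a`.
  set s := (a - 4 * ε) / 5 + ε / 5 with hs
  have hs0 : 0 < s := by rw [hs]; linarith
  -- The displacement has length `r / 4`, so projected chords have length at most `5 r / 16` and
  -- chords at most `5 r / 8`, inside the ball of radius `r`.
  refine h.thick.not_tendsto (y := (1 / (4 * a)) • chartProj ι w) (ρ := 1 / 16) (by norm_num)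
    ?_ (hw.2.2 s hs0)
  intro r hr x hx hxr
  set z := chartProj ι (x - q) with hz
  set u := z - r • ((1 / (4 * a)) • chartProj ι w) with hu
  have hnx : ‖z‖ ≤ r * (5 / 16) := by
    calc ‖z‖ = ‖u + r • ((1 / (4 * a)) • chartProj ι w)‖ := by rw [hu, sub_add_cancel]
      _ ≤ ‖u‖ + ‖r • ((1 / (4 * a)) • chartProj ι w)‖ := norm_add_le _ _
      _ ≤ r * (1 / 16) + r * (1 / 4) := by
          gcongr
          rw [norm_smul, norm_smul, ← ha, Real.norm_of_nonneg hr.le,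
            Real.norm_of_nonneg (by positivity)]
          apply le_of_eq
          field_simp
      _ = _ := by ring
  have hxq : ‖x - q‖ ≤ r * (5 / 8) := by
    have := h.near.norm_sub_le hε h.chart hx h.mem
    linarith
  refine ⟨⟨h.subset hx, ?_⟩, ?_⟩
  · rw [Metric.mem_closedBall, dist_eq_norm]
    linarith
  · have hww : inner ℝ (chartProj ι w) (chartProj ι w) = a ^ 2 := by
      rw [real_inner_self_eq_norm_sq]
    have hd : (inner ℝ (x - q) w : ℝ) = inner ℝ u (chartProj ι w) + r * (a / 4) +
        inner ℝ w₀ (x - q) * inner ℝ w₀ w := by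
      have e1 : (inner ℝ (x - q) w : ℝ) = inner ℝ z (chartProj ι w) +
          inner ℝ w₀ (x - q) * inner ℝ w₀ w := by
        conv_lhs => rw [← h.chart.decomp (x - q)]
        rw [inner_add_left, inner_smul_left, real_inner_comm, ← inner_chartProj, real_inner_comm]
        simp [hz]
      rw [e1, hu, inner_sub_left, inner_smul_left, inner_smul_left, hww]
      simp only [conj_trivial]
      field_simp
      ring
    have h1 : |(inner ℝ u (chartProj ι w) : ℝ)| ≤ r * (1 / 16) * a :=
      (abs_real_inner_le_norm _ _).trans (by gcongr)
    have h2 : |(inner ℝ w₀ (x - q) * inner ℝ w₀ w : ℝ)| ≤ ε * (r * (5 / 8)) := by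
      rw [abs_mul]
      have h3 : |(inner ℝ w₀ w : ℝ)| ≤ 1 := by
        refine (abs_real_inner_le_norm _ _).trans ?_
        rw [h.chart.norm_eq, hw.1, mul_one]
      calc _ ≤ ε * ‖x - q‖ * 1 := mul_le_mul (h.near x hx q h.mem) h3 (abs_nonneg _)
            (by positivity)
        _ ≤ _ := by rw [mul_one]; gcongr
    have h4 : r * (3 * a / 16 - 5 * ε / 8) ≤ |(inner ℝ (x - q) w : ℝ)| := by
      refine le_trans ?_ (le_abs_self _)
      have := neg_abs_le (inner ℝ u (chartProj ι w) : ℝ)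
      have := neg_abs_le (inner ℝ w₀ (x - q) * inner ℝ w₀ w : ℝ)
      rw [hd]
      linarith
    refine lt_of_lt_of_le ?_ h4
    calc s * ‖x - q‖ ≤ s * (r * (5 / 8)) := by gcongr
      _ = r * (s * (5 / 8)) := by ring
      _ < _ := by
        refine mul_lt_mul_of_pos_left ?_ hr
        rw [hs]
        linarith

/-- Split `w` into its tangential part, of norm at most `4 ε`, and `α • w₀`, where then `1 - |α| ≤ 4
ε`; each part costs `4 ε`. -/
theorem IsTangentPieceAt.abs_abs_inner_sub_le (h : IsTangentPieceAt S T ι w₀ ε q) (hε0 : 0 < ε)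
    (hε : ε ≤ 1 / 2) (hw : IsUnitNormalAt S q w) (hv : ‖v‖ = 1) :
    |(|(inner ℝ v w : ℝ)| - |(inner ℝ v w₀ : ℝ)|)| ≤ 8 * ε := by
  have h1 := h.norm_chartProj_le hε0 hε hw
  set α : ℝ := inner ℝ w₀ w with hα
  have hd : ι (chartProj ι w) + α • w₀ = w := h.chart.decomp w
  have hα1 : |α| ≤ 1 := by
    refine (abs_real_inner_le_norm _ _).trans ?_
    rw [h.chart.norm_eq, hw.1, mul_one]
  have hα2 : 1 ≤ 4 * ε + |α| := by
    calc 1 = ‖ι (chartProj ι w) + α • w₀‖ := by rw [hd, hw.1]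
      _ ≤ ‖ι (chartProj ι w)‖ + ‖α • w₀‖ := norm_add_le _ _
      _ ≤ _ := by
        rw [ι.norm_map, norm_smul, h.chart.norm_eq, mul_one, Real.norm_eq_abs]
        gcongr
  have hb : |(inner ℝ v w₀ : ℝ)| ≤ 1 := by
    refine (abs_real_inner_le_norm _ _).trans ?_
    rw [h.chart.norm_eq, hv, mul_one]
  have hvw : (inner ℝ v w : ℝ) = inner ℝ v (ι (chartProj ι w)) + α * inner ℝ v w₀ := by
    conv_lhs => rw [← hd]
    rw [inner_add_right, inner_smul_right]
  have h2 : |(inner ℝ v w : ℝ) - α * inner ℝ v w₀| ≤ 4 * ε := by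
    rw [hvw, add_sub_cancel_right]
    refine (abs_real_inner_le_norm _ _).trans ?_
    rw [hv, one_mul, ι.norm_map]
    exact h1
  have h3 := (abs_abs_sub_abs_le (inner ℝ v w : ℝ) (α * inner ℝ v w₀)).trans h2
  rw [abs_mul] at h3
  have h4 : |(|α| * |(inner ℝ v w₀ : ℝ)| - |(inner ℝ v w₀ : ℝ)|)| ≤ 4 * ε := by
    rw [← sub_one_mul, abs_mul, abs_abs, abs_of_nonpos (by linarith)]
    calc _ ≤ -(|α| - 1) * 1 := by gcongr; linarith
      _ ≤ _ := by linarith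
  calc _ ≤ _ := abs_sub_le _ (|α| * |(inner ℝ v w₀ : ℝ)|) _
    _ ≤ _ := by linarith

theorem IsTangentPieceAt.not_tendsto (h : IsTangentPieceAt S T ι w₀ ε q) (hε : ε ≤ 1 / 2) :
    ¬ Tendsto (fun r : ℝ => (μHE[n - 1] : Measure (EuclideanSpace ℝ (Fin n)))
      (S ∩ Metric.closedBall q r) / ENNReal.ofReal (r ^ (n - 1))) (𝓝[>] 0) (𝓝 0) := by
  refine h.thick.not_tendsto (y := 0) (ρ := 1 / 2) (by norm_num) fun r hr x hx hxr => ?_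
  refine ⟨h.subset hx, ?_⟩
  rw [smul_zero, sub_zero] at hxr
  rw [Metric.mem_closedBall, dist_eq_norm]
  have := h.near.norm_sub_le hε h.chart hx h.mem
  linarith

theorem IsUnitNormalAt.neg (h : IsUnitNormalAt S q w) : IsUnitNormalAt S q (-w) := by
  refine ⟨by rw [norm_neg, h.1], h.2.1, fun s hs => ?_⟩
  simpa only [inner_neg_right, abs_neg] using h.2.2 s hs

/-- The normal is a limit point of the `w₀ j` on the unit sphere. Once `ε j + ‖w - w₀ j‖ < s`, the
piece `T j` lies in the cone of aperture `s`, so what is outside belongs to `S \ T j` and has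
density zero. -/
theorem exists_isUnitNormalAt {T : ℕ → Set (EuclideanSpace ℝ (Fin n))}
    {w₀ : ℕ → EuclideanSpace ℝ (Fin n)} {ε : ℕ → ℝ}
    {ι : ℕ → EuclideanSpace ℝ (Fin (n - 1)) →ₗᵢ[ℝ] EuclideanSpace ℝ (Fin n)}
    (h : ∀ j, IsTangentPieceAt S (T j) (ι j) (w₀ j) (ε j) q) (hε : ∀ j, ε j ≤ 1 / 2)
    (hlim : Tendsto ε atTop (𝓝 0)) : ∃ w, IsUnitNormalAt S q w := by
  obtain ⟨w, hw, φ, hφ, hφw⟩ := (isCompact_sphere (0 : EuclideanSpace ℝ (Fin n)) 1).tendsto_subseq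
    (x := w₀) fun j => by simpa using (h j).chart.norm_eq
  refine ⟨w, by simpa using hw, (h 0).not_tendsto (hε 0), fun s hs => ?_⟩
  have h1 : Tendsto (fun j => ε (φ j) + ‖w - w₀ (φ j)‖) atTop (𝓝 (0 + ‖w - w‖)) :=
    (hlim.comp hφ.tendsto_atTop).add (tendsto_const_nhds.sub hφw).norm
  rw [sub_self, norm_zero, add_zero] at h1
  obtain ⟨j, hj⟩ := (h1.eventually (gt_mem_nhds hs)).exists
  refine tendsto_of_tendsto_of_tendsto_of_le_of_le tendsto_const_nhds (h (φ j)).diff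
    (fun _ => zero_le) fun r => ENNReal.div_le_div_right (measure_mono ?_) _
  rintro x ⟨⟨hxS, hxr⟩, hx⟩
  refine ⟨⟨hxS, fun hxT => ?_⟩, hxr⟩
  have h2 := (h (φ j)).near x hxT q (h (φ j)).mem
  have h3 : |(inner ℝ (x - q) w : ℝ)| ≤ s * ‖x - q‖ := by
    calc |(inner ℝ (x - q) w : ℝ)|
        = |inner ℝ (w₀ (φ j)) (x - q) + inner ℝ (x - q) (w - w₀ (φ j))| := by
          rw [inner_sub_right (x - q) w, real_inner_comm (x - q) (w₀ (φ j))]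
          congr 1; ring
      _ ≤ |inner ℝ (w₀ (φ j)) (x - q)| + |inner ℝ (x - q) (w - w₀ (φ j))| := abs_add_le _ _
      _ ≤ ε (φ j) * ‖x - q‖ + ‖x - q‖ * ‖w - w₀ (φ j)‖ :=
          add_le_add h2 (abs_real_inner_le_norm _ _)
      _ = (ε (φ j) + ‖w - w₀ (φ j)‖) * ‖x - q‖ := by ring
      _ ≤ _ := by gcongr
  exact absurd hx (not_lt.2 h3)

/-- Tested against `v = w'`, both `|⟨w', w⟩|` and `|⟨w', w'⟩| = 1` are within `8 ε j` of `|⟨w', w₀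
j⟩|`, so `|⟨w', w⟩| = 1`. -/
theorem IsUnitNormalAt.eq_or_eq_neg {w' : EuclideanSpace ℝ (Fin n)}
    {T : ℕ → Set (EuclideanSpace ℝ (Fin n))} {w₀ : ℕ → EuclideanSpace ℝ (Fin n)} {ε : ℕ → ℝ}
    {ι : ℕ → EuclideanSpace ℝ (Fin (n - 1)) →ₗᵢ[ℝ] EuclideanSpace ℝ (Fin n)}
    (h : ∀ j, IsTangentPieceAt S (T j) (ι j) (w₀ j) (ε j) q) (hε0 : ∀ j, 0 < ε j)
    (hε : ∀ j, ε j ≤ 1 / 2) (hlim : Tendsto ε atTop (𝓝 0)) (hw : IsUnitNormalAt S q w)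
    (hw' : IsUnitNormalAt S q w') : w' = w ∨ w' = -w := by
  have h1 : ∀ j, |(|(inner ℝ w' w : ℝ)| - 1)| ≤ 16 * ε j := fun j => by
    have h2 := (h j).abs_abs_inner_sub_le (hε0 j) (hε j) hw hw'.1
    have h3 := (h j).abs_abs_inner_sub_le (hε0 j) (hε j) hw' hw'.1
    have h5 : (inner ℝ w' w' : ℝ) = 1 := by rw [real_inner_self_eq_norm_sq, hw'.1, one_pow]
    rw [h5, abs_one, abs_sub_comm] at h3
    calc _ ≤ _ := abs_sub_le _ |(inner ℝ w' (w₀ j) : ℝ)| _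
      _ ≤ _ := by linarith
  have h4 : |(|(inner ℝ w' w : ℝ)| - 1)| ≤ 0 := by
    have := hlim.const_mul 16
    rw [mul_zero] at this
    exact ge_of_tendsto' this h1
  have h6 : |(inner ℝ w' w : ℝ)| = 1 := sub_eq_zero.1 (abs_nonpos_iff.1 h4)
  rcases eq_or_eq_neg_of_abs_eq h6 with h7 | h7
  · exact Or.inl ((inner_eq_one_iff_of_norm_eq_one (𝕜 := ℝ) hw'.1 hw.1).1 h7)
  · refine Or.inr ((inner_eq_one_iff_of_norm_eq_one (𝕜 := ℝ) hw'.1 (by rw [norm_neg, hw.1])).1 ?_)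
    rw [inner_neg_right, h7, neg_neg]

theorem isUnitNormalAt_unitNormal (h : ∃ w, IsUnitNormalAt S q w) :
    IsUnitNormalAt S q (unitNormal S q) := by
  rw [unitNormal, dif_pos h]
  exact h.choose_spec

end Normal

/-! ### Area distortion of a nearly flat piece under projection. -/

section PieceEstimate

variable {E : Type*} [NormedAddCommGroup E] [InnerProductSpace ℝ E] [FiniteDimensional ℝ E]
  {m : ℕ} {ι ι' : EuclideanSpace ℝ (Fin m) →ₗᵢ[ℝ] E} {T S : Set E} {v w : E} {ε : ℝ}

/-- The map lifts a point of the first hyperplane to `T` and projects it to the second. Its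
deviation from the linear projection is `⟨w, x - y⟩` times the projection of `w`. -/
theorem NearHyperplane.approximatesLinearOn (h : NearHyperplane T w ε) (hε : ε ≤ 1 / 2)
    (hι : IsHyperplaneChart ι w) (ι' : EuclideanSpace ℝ (Fin m) →ₗᵢ[ℝ] E) {δ : ℝ≥0}
    (hδ : ε ≤ δ / 2) :
    ∃ f : EuclideanSpace ℝ (Fin m) → EuclideanSpace ℝ (Fin m),
      f '' (chartProj ι '' T) = chartProj ι' '' T ∧
      ApproximatesLinearOn f ((chartProj ι').comp ι.toContinuousLinearMap) (chartProj ι '' T) δ := by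
  have hinj : Set.InjOn (chartProj ι) T := fun x hx y hy hxy => by
    have := h.norm_sub_le hε hι hx hy
    rw [map_sub, hxy, sub_self, norm_zero, mul_zero] at this
    exact sub_eq_zero.1 (norm_le_zero_iff.1 this)
  have hf : ∀ x ∈ T, chartProj ι' (Function.invFunOn (chartProj ι) T (chartProj ι x)) =
      chartProj ι' x := fun x hx => by
    rw [hinj.leftInvOn_invFunOn hx]
  refine ⟨fun z => chartProj ι' (Function.invFunOn (chartProj ι) T z), ?_, ?_⟩
  · rw [Set.image_image]
    exact Set.image_congr hf
  · rintro _ ⟨x, hx, rfl⟩ _ ⟨y, hy, rfl⟩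
    simp only [hf x hx, hf y hy]
    rw [← map_sub, ← map_sub]
    have h1 : chartProj ι' (x - y) -
        ((chartProj ι').comp ι.toContinuousLinearMap) (chartProj ι (x - y)) =
        (inner ℝ w (x - y) : ℝ) • chartProj ι' w := by
      conv_lhs => enter [1]; rw [← hι.decomp (x - y)]
      rw [map_add, map_smul]
      simp
    have h2 : ‖chartProj ι' w‖ ≤ 1 := (norm_chartProj_le _ _).trans_eq hι.norm_eq
    rw [h1, norm_smul, Real.norm_eq_abs]
    calc _ ≤ |(inner ℝ w (x - y) : ℝ)| * 1 := by gcongr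
      _ ≤ ε * ‖x - y‖ := by rw [mul_one]; exact h x hx y hy
      _ ≤ δ / 2 * ‖x - y‖ := by gcongr
      _ ≤ δ / 2 * (2 * ‖chartProj ι (x - y)‖) := by gcongr; exact h.norm_sub_le hε hι hx hy
      _ = _ := by ring

variable [MeasurableSpace E] [BorelSpace E]

theorem exists_volume_image_estimate (hι : IsHyperplaneChart ι w) (hι' : IsHyperplaneChart ι' v)
    {η : ℝ≥0} (hη : 0 < η) :
    ∃ ε : ℝ, 0 < ε ∧ ∀ T : Set E, NearHyperplane T w ε →
      volume (chartProj ι' '' T) ≤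
        (ENNReal.ofReal |inner ℝ v w| + η) * (μHE[m] : Measure E) T ∧
      ENNReal.ofReal |inner ℝ v w| * (μHE[m] : Measure E) T ≤
        volume (chartProj ι' '' T) + η * (μHE[m] : Measure E) T := by
  set A := (chartProj ι').comp ι.toContinuousLinearMap with hA
  have hdet : |A.det| = |inner ℝ v w| := abs_det_chartProj_comp hι hι'
  set c : ℝ≥0 := Real.toNNReal |inner ℝ v w| with hc
  have hofc : ENNReal.ofReal |inner ℝ v w| = c := rfl
  have hup : ∀ᶠ δ in 𝓝[>] (0 : ℝ≥0), ∀ (s : Set (EuclideanSpace ℝ (Fin m)))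
      (f : EuclideanSpace ℝ (Fin m) → EuclideanSpace ℝ (Fin m)),
      ApproximatesLinearOn f A s δ → volume (f '' s) ≤ ((c + η : ℝ≥0) : ℝ≥0∞) * volume s := by
    refine addHaar_image_le_mul_of_det_lt volume A ?_
    rw [hdet, hofc, ENNReal.coe_lt_coe]
    exact lt_add_of_pos_right _ hη
  have hlow : ∃ K : ℝ≥0, 1 < K ∧ ∀ᶠ δ in 𝓝[>] (0 : ℝ≥0), ∀ (s : Set (EuclideanSpace ℝ (Fin m)))
      (f : EuclideanSpace ℝ (Fin m) → EuclideanSpace ℝ (Fin m)), ApproximatesLinearOn f A s δ →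
        (c : ℝ≥0∞) * (K : ℝ≥0∞) ^ m * volume s ≤ volume (f '' s) + η * volume s := by
    -- `K ^ m` bounds the area of `T` by that of its flat projection; `K` is so near 1 that this
    -- loss is absorbed by `η`.
    have hK : ∃ K : ℝ≥0, 1 < K ∧ c * K ^ m < c + η := by
      have hcont : Tendsto (fun K : ℝ≥0 => c * K ^ m) (𝓝[>] 1) (𝓝 (c * 1 ^ m)) :=
        ((continuous_const.mul (continuous_pow m)).tendsto 1).mono_left nhdsWithin_le_nhds
      rw [one_pow, mul_one] at hcont
      obtain ⟨K, h1, h2⟩ := ((hcont.eventually (gt_mem_nhds (lt_add_of_pos_right c hη))).and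
        self_mem_nhdsWithin).exists
      exact ⟨K, h2, h1⟩
    obtain ⟨K, hK1, hK⟩ := hK
    refine ⟨K, hK1, ?_⟩
    rcases le_or_gt (c * K ^ m) η with hle | hlt
    · refine Eventually.of_forall fun δ s f _ => le_add_left ?_
      gcongr
      exact_mod_cast hle
    · have hlt' : ((c * K ^ m - η : ℝ≥0) : ℝ≥0∞) < ENNReal.ofReal |A.det| := by
        rw [hdet, hofc, ENNReal.coe_lt_coe]
        exact (tsub_lt_iff_right hlt.le).2 hK
      filter_upwards [mul_le_addHaar_image_of_lt_det volume A hlt'] with δ hδ s f hf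
      calc (c : ℝ≥0∞) * (K : ℝ≥0∞) ^ m * volume s
          = ((c * K ^ m - η + η : ℝ≥0) : ℝ≥0∞) * volume s := by
            rw [tsub_add_cancel_of_le hlt.le]; push_cast; rfl
        _ = ((c * K ^ m - η : ℝ≥0) : ℝ≥0∞) * volume s + η * volume s := by
            rw [ENNReal.coe_add, add_mul]
        _ ≤ _ := by gcongr; exact hδ s f hf
  obtain ⟨K, hK1, hlow⟩ := hlow
  obtain ⟨δ, ⟨hδup, hδlow⟩, hδ0⟩ := ((hup.and hlow).and self_mem_nhdsWithin).exists
  have hK0 : (0 : ℝ) < K := by exact_mod_cast zero_lt_one.trans hK1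
  have hK1' : (1 : ℝ) < K := by exact_mod_cast hK1
  have hδ0' : (0 : ℝ) < δ := hδ0
  refine ⟨min (1 / 2) (min (δ / 2) (1 - 1 / K)), lt_min (by norm_num) (lt_min (by positivity)
    (sub_pos.2 ((div_lt_one hK0).2 hK1'))), fun T hT => ?_⟩
  have hε : min (1 / 2 : ℝ) (min (δ / 2) (1 - 1 / K)) ≤ 1 / 2 := min_le_left _ _
  obtain ⟨f, hfT, hf⟩ := hT.approximatesLinearOn hε hι ι' (δ := δ)
    ((min_le_right _ _).trans (min_le_left _ _))
  have h1 := hδup _ f hf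
  have h2 := hδlow _ f hf
  rw [hfT] at h1 h2
  have h3 := volume_chartProj_image_le ι T
  have h4 := (hT.mono_right ((min_le_right _ _).trans
    (min_le_right _ _))).measure_le_mul_volume_image (K := K) (by field_simp; simp) hι
  rw [hofc]
  constructor
  · refine h1.trans ?_
    rw [ENNReal.coe_add]
    gcongr
  · calc (c : ℝ≥0∞) * (μHE[m] : Measure E) T
        ≤ c * ((K : ℝ≥0∞) ^ m * volume (chartProj ι '' T)) := by gcongr
      _ ≤ volume (chartProj ι' '' T) + η * volume (chartProj ι '' T) := by
          rw [← mul_assoc]; exact h2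
      _ ≤ _ := by gcongr

omit [MeasurableSpace E] [BorelSpace E] in
-- A chord inside a fibre would be parallel to `v`, which is too steep for `T`.
theorem NearHyperplane.injOn_chartProj (h : NearHyperplane T w ε)
    (hι' : IsHyperplaneChart ι' v) (hε : ε < |inner ℝ v w|) : Set.InjOn (chartProj ι') T := by
  intro x hx y hy hxy
  have h1 := hι'.decomp (x - y)
  rw [map_sub, hxy, sub_self, map_zero, zero_add] at h1
  have h2 := h x hx y hy
  rw [← h1, inner_smul_right, norm_smul, hι'.norm_eq, mul_one, abs_mul, real_inner_comm v w,
    Real.norm_eq_abs, mul_comm ε] at h2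
  by_contra hne
  have h3 : 0 < |(inner ℝ v (x - y) : ℝ)| := by
    refine abs_pos.2 fun h0 => hne ?_
    rw [h0, zero_smul] at h1
    exact sub_eq_zero.1 h1.symm
  exact absurd (le_of_mul_le_mul_left h2 h3) (not_le.2 hε)

end PieceEstimate

/-! ### Measures and integrals along a partition. -/

section Partition

variable {E : Type*} [NormedAddCommGroup E] [InnerProductSpace ℝ E] [MeasurableSpace E]
  [BorelSpace E] {m : ℕ} {S : Set E}

theorem IsNearHyperplanePartition.restrict_eq {T : ℕ → Set E} {w : ℕ → E} {ε : E → ℝ}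
    (h : IsNearHyperplanePartition m S ε T w) :
    (μHE[m] : Measure E).restrict S = Measure.sum fun k => (μHE[m] : Measure E).restrict (T k) := by
  rw [← Measure.restrict_iUnion h.disjoint h.measurableSet]
  refine Measure.restrict_congr_set ?_
  refine (ae_le_set.2 h.null).antisymm ?_
  exact LE.le.eventuallyLE (Set.iUnion_subset h.subset)

theorem IsNearHyperplanePartition.ae_exists {T : ℕ → Set E} {w : ℕ → E} {ε : E → ℝ}
    (h : IsNearHyperplanePartition m S ε T w) {P : ℕ → E → Prop}
    (hP : ∀ k, ∀ᵐ q ∂((μHE[m] : Measure E).restrict (T k)), P k q) :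
    ∀ᵐ q ∂((μHE[m] : Measure E).restrict S), ∃ k, P k q := by
  rw [h.restrict_eq, Measure.ae_sum_iff]
  exact fun k => (hP k).mono fun q hq => ⟨k, hq⟩

theorem IsNearHyperplanePartition.lintegral_eq {T : ℕ → Set E} {w : ℕ → E} {ε : E → ℝ}
    (h : IsNearHyperplanePartition m S ε T w) (f : E → ℝ≥0∞) :
    ∫⁻ q in S, f q ∂μHE[m] = ∑' k, ∫⁻ q in T k, f q ∂μHE[m] := by
  rw [h.restrict_eq, lintegral_sum_measure]

theorem IsNearHyperplanePartition.measure_eq {T : ℕ → Set E} {w : ℕ → E} {ε : E → ℝ}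
    (h : IsNearHyperplanePartition m S ε T w) :
    (μHE[m] : Measure E) S = ∑' k, (μHE[m] : Measure E) (T k) := by
  simpa using h.lintegral_eq fun _ => 1

theorem IsNearHyperplanePartition.inter {T : ℕ → Set E} {w : ℕ → E} {ε : E → ℝ}
    (h : IsNearHyperplanePartition m S ε T w) {B : Set E} (hB : MeasurableSet B) (hBS : B ⊆ S) :
    IsNearHyperplanePartition m B ε (fun k => T k ∩ B) w where
  measurableSet k := (h.measurableSet k).inter hB
  disjoint i j hij := (h.disjoint hij).mono Set.inter_subset_left Set.inter_subset_left
  subset k := Set.inter_subset_right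
  norm_eq := h.norm_eq
  near k := (h.near k).mono Set.inter_subset_left
  null := by
    refine measure_mono_null ?_ h.null
    rintro x ⟨hxB, hx⟩
    refine ⟨hBS hxB, fun hxT => hx ?_⟩
    rw [← Set.iUnion_inter]
    exact ⟨hxT, hxB⟩

end Partition

/-! ### The area formula for compact hypersurfaces. -/

section Hypersurface

variable {n : ℕ} {S T B : Set (EuclideanSpace ℝ (Fin n))} {v w : EuclideanSpace ℝ (Fin n)} {ε : ℝ}
  {ι : EuclideanSpace ℝ (Fin (n - 1)) →ₗᵢ[ℝ] EuclideanSpace ℝ (Fin n)}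

theorem finrank_euclideanSpace_eq_pred_add_one (hn : 1 ≤ n) :
    Module.finrank ℝ (EuclideanSpace ℝ (Fin n)) = n - 1 + 1 := by
  rw [finrank_euclideanSpace_fin, Nat.sub_add_cancel hn]

theorem exists_isHyperplaneChart_euclideanSpace (hn : 1 ≤ n) (hw : ‖w‖ = 1) :
    ∃ ι : EuclideanSpace ℝ (Fin (n - 1)) →ₗᵢ[ℝ] EuclideanSpace ℝ (Fin n), IsHyperplaneChart ι w :=
  (exists_isHyperplaneChart (finrank_euclideanSpace_eq_pred_add_one hn) hw).imp' _ fun _ => id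

theorem IsCompactHypersurface.exists_partition (hS : IsCompactHypersurface S) (hn : 1 ≤ n)
    {ε : EuclideanSpace ℝ (Fin n) → ℝ} (hε : ∀ w, 0 < ε w) :
    ∃ T w, IsNearHyperplanePartition (n - 1) S ε T w :=
  exists_isNearHyperplanePartition (finrank_euclideanSpace_eq_pred_add_one hn)
    hS.isCompact.measurableSet hS.rectifiable hε

theorem IsCompactHypersurface.exists_partition_isTangentPieceAt (hS : IsCompactHypersurface S)
    (hn : 1 ≤ n) (hε0 : 0 < ε) (hε : ε ≤ 1 / 2) :
    ∃ (T : ℕ → Set (EuclideanSpace ℝ (Fin n))) (w : ℕ → EuclideanSpace ℝ (Fin n))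
      (ι : ℕ → EuclideanSpace ℝ (Fin (n - 1)) →ₗᵢ[ℝ] EuclideanSpace ℝ (Fin n)),
      IsNearHyperplanePartition (n - 1) S (fun _ => ε) T w ∧
      ∀ᵐ q ∂((μHE[n - 1] : Measure (EuclideanSpace ℝ (Fin n))).restrict S),
        ∃ k, IsTangentPieceAt S (T k) (ι k) (w k) ε q := by
  obtain ⟨T, w, hT⟩ := hS.exists_partition hn (ε := fun _ => ε) fun _ => hε0
  choose ι hι using fun k => exists_isHyperplaneChart_euclideanSpace hn (hT.norm_eq k)
  exact ⟨T, w, ι, hT, hT.ae_exists fun k => (hT.near k).ae_isTangentPieceAt hε (hι k)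
    (hT.measurableSet k) (hT.subset k) hS.measure_lt_top⟩

theorem apertures_spec : (∀ j : ℕ, 0 < (1 / 2 : ℝ) / (j + 1)) ∧
    (∀ j : ℕ, (1 / 2 : ℝ) / (j + 1) ≤ 1 / 2) ∧
    Tendsto (fun j : ℕ => (1 / 2 : ℝ) / (j + 1)) atTop (𝓝 0) := by
  refine ⟨fun j => by positivity, fun j => div_le_self (by norm_num) (by simp), ?_⟩
  have := (tendsto_one_div_add_atTop_nhds_zero_nat (𝕜 := ℝ)).const_mul (1 / 2)
  rw [mul_zero] at this
  exact this.congr fun j => by ring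

theorem IsCompactHypersurface.ae_isUnitNormalAt_iff (hS : IsCompactHypersurface S) (hn : 1 ≤ n) :
    ∀ᵐ q ∂((μHE[n - 1] : Measure (EuclideanSpace ℝ (Fin n))).restrict S),
      ∀ w, IsUnitNormalAt S q w ↔ w = unitNormal S q ∨ w = -unitNormal S q := by
  obtain ⟨h0, h1, h2⟩ := apertures_spec
  choose T w ι hT hae using fun j => hS.exists_partition_isTangentPieceAt hn (h0 j) (h1 j)
  filter_upwards [ae_all_iff.2 hae] with q hq
  choose k hk using hq
  have hex := isUnitNormalAt_unitNormal (exists_isUnitNormalAt hk h1 h2)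
  refine fun w => ⟨fun hw => hex.eq_or_eq_neg hk h0 h1 h2 hw, ?_⟩
  rintro (rfl | rfl)
  exacts [hex, hex.neg]

theorem IsCompactHypersurface.ae_isUnitNormalAt_unitNormal (hS : IsCompactHypersurface S)
    (hn : 1 ≤ n) :
    ∀ᵐ q ∂((μHE[n - 1] : Measure (EuclideanSpace ℝ (Fin n))).restrict S),
      IsUnitNormalAt S q (unitNormal S q) := by
  filter_upwards [hS.ae_isUnitNormalAt_iff hn] with q hq
  exact (hq _).2 (Or.inl rfl)

/-- `unitNormal` is an arbitrary choice, but the integrand is the almost everywhere limit of step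
functions with value `|⟨v, w j k⟩|` on `T j k`. -/
theorem IsCompactHypersurface.aemeasurable_abs_inner_unitNormal (hS : IsCompactHypersurface S)
    (hn : 1 ≤ n) (hv : ‖v‖ = 1) :
    AEMeasurable (fun q => ENNReal.ofReal |inner ℝ v (unitNormal S q)|)
      ((μHE[n - 1] : Measure (EuclideanSpace ℝ (Fin n))).restrict S) := by
  obtain ⟨h0, h1, h2⟩ := apertures_spec
  choose T w ι hT hae using fun j => hS.exists_partition_isTangentPieceAt hn (h0 j) (h1 j)
  refine aemeasurable_of_tendsto_metrizable_ae' (f := fun j q => ∑' k,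
    (T j k).indicator (fun _ => ENNReal.ofReal |(inner ℝ v (w j k) : ℝ)|) q) (fun j =>
    (Measurable.tsum fun k =>
      measurable_const.indicator ((hT j).measurableSet k)).aemeasurable) ?_
  filter_upwards [ae_all_iff.2 hae, hS.ae_isUnitNormalAt_unitNormal hn] with q hq hnq
  choose k hk using hq
  have hval : ∀ j, ∑' i, (T j i).indicator (fun _ => ENNReal.ofReal |(inner ℝ v (w j i) : ℝ)|) q =
      ENNReal.ofReal |(inner ℝ v (w j (k j)) : ℝ)| := fun j => by
    rw [tsum_eq_single (k j), Set.indicator_of_mem (hk j).mem]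
    intro i hi
    exact Set.indicator_of_notMem
      (fun hqi => Set.disjoint_left.1 ((hT j).disjoint hi) hqi (hk j).mem) _
  simp only [hval]
  refine ENNReal.tendsto_ofReal ?_
  rw [tendsto_iff_dist_tendsto_zero]
  refine squeeze_zero (fun _ => dist_nonneg) (g := fun j : ℕ => 8 * ((1 / 2 : ℝ) / (j + 1)))
    (fun j => ?_) (by simpa only [mul_zero] using h2.const_mul 8)
  rw [dist_comm, Real.dist_eq]
  exact (hk j).abs_abs_inner_sub_le (h0 j) (h1 j) hnq hv

/-- The projection changes the area of a piece of `S` that is sufficiently close to a hyperplane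
by a factor which is essentially the integral mean of `|⟨v, ν⟩|`. -/
theorem IsCompactHypersurface.exists_aperture (hS : IsCompactHypersurface S) (hn : 1 ≤ n)
    (hι : IsHyperplaneChart ι v) {η : ℝ≥0} (hη : 0 < η) (w : EuclideanSpace ℝ (Fin n)) :
    ∃ ε : ℝ, 0 < ε ∧ (‖w‖ = 1 → ∀ T ⊆ S, MeasurableSet T → NearHyperplane T w ε →
      volume (chartProj ι '' T) ≤
        ∫⁻ q in T, ENNReal.ofReal |inner ℝ v (unitNormal S q)| ∂μHE[n - 1] +
          η * (2 * (μHE[n - 1] : Measure (EuclideanSpace ℝ (Fin n))) T) ∧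
      ∫⁻ q in T, ENNReal.ofReal |inner ℝ v (unitNormal S q)| ∂μHE[n - 1] ≤
        volume (chartProj ι '' T) +
          η * (2 * (μHE[n - 1] : Measure (EuclideanSpace ℝ (Fin n))) T)) := by
  by_cases hw : ‖w‖ = 1
  swap
  · exact ⟨1, one_pos, fun h => absurd h hw⟩
  obtain ⟨ι', hι'⟩ := exists_isHyperplaneChart_euclideanSpace hn hw
  obtain ⟨ε, hε, hest⟩ := exists_volume_image_estimate hι' hι hη
  -- The bound `η / 8` keeps `|⟨v, ν⟩|` within `η` of `|⟨v, w⟩|`. Together with the area distortion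
  -- this makes two errors of `η` times the area.
  refine ⟨min ε (min (1 / 2) (η / 8)), by positivity, fun _ T hTS hTm hT => ?_⟩
  set δ : ℝ := min ε (min (1 / 2) (η / 8)) with hδ
  have hδ0 : 0 < δ := by positivity
  have hδ2 : δ ≤ 1 / 2 := (min_le_right _ _).trans (min_le_left _ _)
  have hδ8 : δ ≤ η / 8 := (min_le_right _ _).trans (min_le_right _ _)
  obtain ⟨hup, hlow⟩ := hest T (hT.mono_right (min_le_left _ _))
  have hnear : ∀ᵐ q ∂((μHE[n - 1] : Measure (EuclideanSpace ℝ (Fin n))).restrict T),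
      |(|(inner ℝ v (unitNormal S q) : ℝ)| - |(inner ℝ v w : ℝ)|)| ≤ η := by
    filter_upwards [hT.ae_isTangentPieceAt hδ2 hι' hTm hTS hS.measure_lt_top,
      ae_mono (Measure.restrict_mono hTS le_rfl) (hS.ae_isUnitNormalAt_unitNormal hn)] with q h1 h2
    refine (h1.abs_abs_inner_sub_le hδ0 hδ2 h2 hι.norm_eq).trans ?_
    linarith
  have hcT : ∀ c : ℝ≥0∞, c * (μHE[n - 1] : Measure (EuclideanSpace ℝ (Fin n))) T =
      ∫⁻ _ in T, c ∂μHE[n - 1] := fun c => (setLIntegral_const _ _).symm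
  have hη' : ENNReal.ofReal η = η := ENNReal.ofReal_coe_nnreal
  constructor
  · refine hup.trans ?_
    rw [two_mul, mul_add, ← add_assoc, add_mul]
    gcongr
    rw [hcT, hcT, ← lintegral_add_right _ measurable_const]
    refine lintegral_mono_ae ?_
    filter_upwards [hnear] with q hq
    rw [← hη', ← ENNReal.ofReal_add (abs_nonneg _) η.coe_nonneg]
    refine ENNReal.ofReal_le_ofReal ?_
    have := (abs_le.1 hq).1
    linarith
  · calc _ ≤ ∫⁻ q in T, (ENNReal.ofReal |inner ℝ v w| + η) ∂μHE[n - 1] := by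
          refine lintegral_mono_ae ?_
          filter_upwards [hnear] with q hq
          rw [← hη', ← ENNReal.ofReal_add (abs_nonneg _) η.coe_nonneg]
          refine ENNReal.ofReal_le_ofReal ?_
          have := (abs_le.1 hq).2
          linarith
      _ = ENNReal.ofReal |inner ℝ v w| * (μHE[n - 1] : Measure (EuclideanSpace ℝ (Fin n))) T +
            η * (μHE[n - 1] : Measure (EuclideanSpace ℝ (Fin n))) T := by
          rw [← hcT, add_mul]
      _ ≤ _ := by
          rw [two_mul, mul_add, ← add_assoc]
          gcongr

/-- Subadditivity over the pieces suffices here, so projections may overlap. This shows that a set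
where `ν ⊥ v` almost everywhere has null projection. -/
theorem volume_chartProj_image_le_lintegral (hS : IsCompactHypersurface S) (hn : 1 ≤ n)
    (hι : IsHyperplaneChart ι v) (hB : MeasurableSet B) (hBS : B ⊆ S) :
    volume (chartProj ι '' B) ≤
      ∫⁻ q in B, ENNReal.ofReal |inner ℝ v (unitNormal S q)| ∂μHE[n - 1] := by
  have hBfin := (measure_mono hBS).trans_lt hS.measure_lt_top
  refine ENNReal.le_of_forall_le_add_mul (ENNReal.mul_ne_top (ENNReal.ofNat_ne_top (n := 2)) hBfin.ne)
    fun η hη => ?_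
  choose ε hε hest using hS.exists_aperture hn hι hη
  obtain ⟨T, w, hT⟩ := hS.exists_partition hn hε
  have hTB := hT.inter hB hBS
  have hnull := nonpos_iff_eq_zero.1 ((volume_chartProj_image_le ι _).trans hTB.null.le)
  calc volume (chartProj ι '' B)
      ≤ volume ((chartProj ι '' (B \ ⋃ k, T k ∩ B)) ∪ ⋃ k, chartProj ι '' (T k ∩ B)) := by
        refine measure_mono ?_
        rw [← Set.image_iUnion, ← Set.image_union]
        exact Set.image_mono fun x hx => by by_cases h : x ∈ ⋃ k, T k ∩ B <;> simp_all
    _ ≤ ∑' k, volume (chartProj ι '' (T k ∩ B)) := by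
        refine (measure_union_le _ _).trans ?_
        rw [hnull, zero_add]
        exact measure_iUnion_le _
    _ ≤ _ := ENNReal.tsum_le_tsum fun k => (hest (w k) (hTB.norm_eq k) _
        ((hTB.subset k).trans hBS) (hTB.measurableSet k) (hTB.near k)).1
    _ = _ := by
        rw [ENNReal.tsum_add, ← hTB.lintegral_eq, ENNReal.tsum_mul_left, ENNReal.tsum_mul_left,
          ← hTB.measure_eq]

theorem measurableSet_chartProj_image (hB : MeasurableSet B) (hinj : Set.InjOn (chartProj ι) B) :
    MeasurableSet (chartProj ι '' B) :=
  hB.image_of_continuousOn_injOn (chartProj ι).continuous.continuousOn hinj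

/-- Injectivity makes the projected pieces disjoint and, by Lusin–Souslin, measurable, so their
volumes add up and the lower estimates can be summed. -/
theorem lintegral_eq_volume_chartProj_image (hS : IsCompactHypersurface S) (hn : 1 ≤ n)
    (hι : IsHyperplaneChart ι v) (hB : MeasurableSet B) (hBS : B ⊆ S)
    (hinj : Set.InjOn (chartProj ι) B) :
    ∫⁻ q in B, ENNReal.ofReal |inner ℝ v (unitNormal S q)| ∂μHE[n - 1] =
      volume (chartProj ι '' B) := by
  refine le_antisymm ?_ (volume_chartProj_image_le_lintegral hS hn hι hB hBS)
  have hBfin := (measure_mono hBS).trans_lt hS.measure_lt_top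
  refine ENNReal.le_of_forall_le_add_mul (ENNReal.mul_ne_top (ENNReal.ofNat_ne_top (n := 2)) hBfin.ne)
    fun η hη => ?_
  choose ε hε hest using hS.exists_aperture hn hι hη
  obtain ⟨T, w, hT⟩ := hS.exists_partition hn hε
  have hTB := hT.inter hB hBS
  calc _ = ∑' k, ∫⁻ q in T k ∩ B, ENNReal.ofReal |inner ℝ v (unitNormal S q)| ∂μHE[n - 1] :=
        hTB.lintegral_eq _
    _ ≤ _ := ENNReal.tsum_le_tsum fun k => (hest (w k) (hTB.norm_eq k) _
        ((hTB.subset k).trans hBS) (hTB.measurableSet k) (hTB.near k)).2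
    _ = volume (⋃ k, chartProj ι '' (T k ∩ B)) +
          η * (2 * (μHE[n - 1] : Measure (EuclideanSpace ℝ (Fin n))) B) := by
        rw [ENNReal.tsum_add, ENNReal.tsum_mul_left, ENNReal.tsum_mul_left, ← hTB.measure_eq,
          measure_iUnion]
        · intro i j hij
          refine Set.disjoint_left.2 ?_
          rintro _ ⟨x, hx, rfl⟩ ⟨y, hy, hxy⟩
          rw [hinj (hTB.subset j hy) (hTB.subset i hx) hxy] at hy
          exact Set.disjoint_left.1 (hTB.disjoint hij) hx hy
        · exact fun k => measurableSet_chartProj_image (hTB.measurableSet k)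
            (hinj.mono (hTB.subset k))
    _ ≤ _ := by
        gcongr
        exact Set.iUnion_subset fun k => Set.image_mono (hTB.subset k)

/-- `S` is, up to a set where the normal is orthogonal to `v`, a countable disjoint union of
measurable graphs over the hyperplane orthogonal to `v`. -/
theorem IsCompactHypersurface.exists_graph_partition (hS : IsCompactHypersurface S) (hn : 1 ≤ n)
    (hι : IsHyperplaneChart ι v) :
    ∃ D : ℕ → Set (EuclideanSpace ℝ (Fin n)), (∀ i, MeasurableSet (D i)) ∧
      Pairwise (Function.onFun Disjoint D) ∧ (∀ i, D i ⊆ S) ∧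
      (∀ i, Set.InjOn (chartProj ι) (D i)) ∧
      ∫⁻ q in S \ ⋃ i, D i, ENNReal.ofReal |inner ℝ v (unitNormal S q)| ∂μHE[n - 1] = 0 := by
  obtain ⟨h0, h1, h2⟩ := apertures_spec
  choose T w κ hT hae using fun j => hS.exists_partition_isTangentPieceAt hn (h0 j) (h1 j)
  -- The condition does not involve `x`: it keeps or discards whole pieces, keeping those steep
  -- enough for `NearHyperplane.injOn_chartProj`.
  set G : ℕ → Set (EuclideanSpace ℝ (Fin n)) := fun i =>
    {x ∈ T i.unpair.1 i.unpair.2 |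
      (1 / 2 : ℝ) / (i.unpair.1 + 1) < |(inner ℝ v (w i.unpair.1 i.unpair.2) : ℝ)|} with hG
  have hGsub : ∀ i, G i ⊆ T i.unpair.1 i.unpair.2 := fun i => Set.sep_subset _ _
  have hGm : ∀ i, MeasurableSet (G i) := fun i =>
    ((hT _).measurableSet _).inter (MeasurableSet.const _)
  refine ⟨disjointed G, MeasurableSet.disjointed hGm, disjoint_disjointed _,
    fun i => ((disjointed_subset _ _).trans (hGsub i)).trans ((hT _).subset _), fun i => ?_, ?_⟩
  · refine Set.InjOn.mono (disjointed_subset _ _) ?_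
    intro x hx
    exact (((hT _).near _).mono (hGsub i)).injOn_chartProj hι hx.2 hx
  · rw [iUnion_disjointed]
    have hZm : MeasurableSet (S \ ⋃ i, G i) :=
      hS.isCompact.measurableSet.diff (MeasurableSet.iUnion hGm)
    refine (lintegral_congr_ae ?_).trans lintegral_zero
    filter_upwards [ae_restrict_mem hZm, ae_mono (Measure.restrict_mono Set.sdiff_subset le_rfl)
      (ae_all_iff.2 hae), ae_mono (Measure.restrict_mono Set.sdiff_subset le_rfl)
      (hS.ae_isUnitNormalAt_unitNormal hn)] with q hqZ hq hnq
    choose k hk using hq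
    -- At every scale `q` lies in a discarded piece: one aperture bounds `|⟨v, w⟩|`, and eight more
    -- pass to the normal.
    have hle : ∀ j : ℕ, |(inner ℝ v (unitNormal S q) : ℝ)| ≤ 9 * ((1 / 2 : ℝ) / (j + 1)) := by
      intro j
      have h3 := (abs_le.1 ((hk j).abs_abs_inner_sub_le (h0 j) (h1 j) hnq hι.norm_eq)).2
      have h4 : |(inner ℝ v (w j (k j)) : ℝ)| ≤ (1 / 2 : ℝ) / (j + 1) := by
        by_contra! hlt
        refine hqZ.2 (Set.mem_iUnion.2 ⟨Nat.pair j (k j), ?_⟩)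
        simp only [hG, Nat.unpair_pair]
        exact ⟨(hk j).mem, hlt⟩
      linarith
    have hlim := h2.const_mul 9
    rw [mul_zero] at hlim
    rw [ENNReal.ofReal_eq_zero]
    exact ge_of_tendsto' hlim hle

/-- The area formula for the projection of `S` along `v`, in coordinates on the hyperplane. -/
theorem IsCompactHypersurface.lintegral_encard_fiber (hS : IsCompactHypersurface S) (hn : 1 ≤ n)
    (hι : IsHyperplaneChart ι v) :
    AEMeasurable (fun y => (((chartProj ι ⁻¹' {y}) ∩ S).encard : ℝ≥0∞)) ∧
    ∫⁻ y, (((chartProj ι ⁻¹' {y}) ∩ S).encard : ℝ≥0∞) =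
      ∫⁻ q in S, ENNReal.ofReal |inner ℝ v (unitNormal S q)| ∂μHE[n - 1] := by
  obtain ⟨D, hDm, hDd, hDS, hDinj, hD0⟩ := hS.exists_graph_partition hn hι
  have hPm := fun i => measurableSet_chartProj_image (hDm i) (hDinj i)
  have hUm := MeasurableSet.iUnion hDm
  have hUS : ⋃ i, D i ⊆ S := Set.iUnion_subset hDS
  have hZ : volume (chartProj ι '' (S \ ⋃ i, D i)) = 0 :=
    nonpos_iff_eq_zero.1 ((volume_chartProj_image_le_lintegral hS hn hι
      (hS.isCompact.measurableSet.diff hUm) Set.sdiff_subset).trans hD0.le)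
  have hmeas : Measurable fun y => ∑' i, (chartProj ι '' D i).indicator (1 : EuclideanSpace ℝ (Fin (n - 1)) → ℝ≥0∞) y :=
    Measurable.tsum fun i => measurable_one.indicator (hPm i)
  have hae : (fun y => ∑' i, (chartProj ι '' D i).indicator (1 : EuclideanSpace ℝ (Fin (n - 1)) → ℝ≥0∞) y) =ᵐ[volume]
      fun y => (((chartProj ι ⁻¹' {y}) ∩ S).encard : ℝ≥0∞) := by
    -- Off this null set the fibre of `S` over `y` lies in the graphs, each of which meets it at
    -- most once.
    filter_upwards [compl_mem_ae_iff.2 hZ] with y hy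
    have hFm : MeasurableSet (chartProj ι ⁻¹' {y}) :=
      (chartProj ι).continuous.measurable (measurableSet_singleton y)
    have hfib : (chartProj ι ⁻¹' {y}) ∩ S = ⋃ i, (chartProj ι ⁻¹' {y}) ∩ D i := by
      rw [← Set.inter_iUnion]
      refine (Set.inter_subset_inter_right _ hUS).antisymm' ?_
      rintro x ⟨hx, hxS⟩
      refine ⟨hx, ?_⟩
      by_contra hxD
      exact hy ⟨x, ⟨hxS, hxD⟩, hx⟩
    rw [← Measure.count_apply (hFm.inter hS.isCompact.measurableSet), hfib, measure_iUnion
      (fun i j hij => (hDd hij).mono Set.inter_subset_right Set.inter_subset_right)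
      (fun i => hFm.inter (hDm i))]
    refine tsum_congr fun i => ?_
    by_cases hyi : y ∈ chartProj ι '' D i
    · obtain ⟨x, hx, rfl⟩ := hyi
      have hsing : (chartProj ι ⁻¹' {chartProj ι x}) ∩ D i = {x} := by
        refine Set.eq_singleton_iff_unique_mem.2 ⟨⟨rfl, hx⟩, ?_⟩
        exact fun z hz => hDinj i hz.2 hx hz.1
      rw [hsing, Measure.count_singleton, Set.indicator_of_mem (Set.mem_image_of_mem _ hx), Pi.one_apply]
    · have hemp : (chartProj ι ⁻¹' {y}) ∩ D i = ∅ :=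
        Set.eq_empty_of_forall_notMem fun x hx => hyi ⟨x, hx.2, hx.1⟩
      rw [hemp, measure_empty, Set.indicator_of_notMem hyi]
  refine ⟨hmeas.aemeasurable.congr hae, ?_⟩
  rw [← lintegral_congr_ae hae, lintegral_tsum fun i => (measurable_one.indicator (hPm i)).aemeasurable,
    ← lintegral_inter_add_sdiff _ S hUm, hD0, add_zero, Set.inter_eq_right.2 hUS,
    lintegral_iUnion hDm hDd]
  refine tsum_congr fun i => ?_
  rw [lintegral_indicator_one (hPm i),
    lintegral_eq_volume_chartProj_image hS hn hι (hDm i) (hDS i) (hDinj i)]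

end Hypersurface

/-! ### From coordinates back to lines and the orthogonal complement. -/

theorem lineCount_eq_encard_fiber {n : ℕ} {S : Set (EuclideanSpace ℝ (Fin n))}
    {v u : EuclideanSpace ℝ (Fin n)}
    {ι : EuclideanSpace ℝ (Fin (n - 1)) →ₗᵢ[ℝ] EuclideanSpace ℝ (Fin n)}
    (hι : IsHyperplaneChart ι v) :
    lineCount S v u = (((chartProj ι ⁻¹' {chartProj ι u}) ∩ S).encard : ℝ≥0∞) := by
  rw [lineCount]
  congr 3
  ext x
  rw [SetLike.mem_coe, AffineSubspace.mem_mk', vsub_eq_sub, Submodule.mem_span_singleton,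
    Set.mem_preimage, Set.mem_singleton_iff, ← sub_eq_zero (b := chartProj ι u), ← map_sub]
  constructor
  · rintro ⟨c, hc⟩
    rw [← hc, map_smul, hι.chartProj_normal, smul_zero]
  · intro h
    refine ⟨inner ℝ v (x - u), ?_⟩
    conv_rhs => rw [← hι.decomp (x - u), h, map_zero, zero_add]

theorem lemma2 (n : ℕ) (hn : 1 ≤ n) (S : Set (EuclideanSpace ℝ (Fin n)))
    (hS : IsCompactHypersurface S) (v : EuclideanSpace ℝ (Fin n)) (hv : ‖v‖ = 1) :
    -- the unit normal exists and is unique up to sign at almost every point of `S`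
    (∀ᵐ q ∂((μHE[n - 1] : Measure (EuclideanSpace ℝ (Fin n))).restrict S),
      ∀ w, IsUnitNormalAt S q w ↔ w = unitNormal S q ∨ w = -unitNormal S q) ∧
    -- both integrands are measurable
    AEMeasurable (fun q => ENNReal.ofReal |inner ℝ v (unitNormal S q)|)
      ((μHE[n - 1] : Measure (EuclideanSpace ℝ (Fin n))).restrict S) ∧
    AEMeasurable (fun u : (ℝ ∙ v)ᗮ => lineCount S v (u : EuclideanSpace ℝ (Fin n))) volume ∧
    -- the formula
    weightedProjectedArea S v =
      (1 / 2) * ∫⁻ u : (ℝ ∙ v)ᗮ, lineCount S v (u : EuclideanSpace ℝ (Fin n)) := by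
  obtain ⟨e, hι⟩ := exists_isHyperplaneChart (finrank_euclideanSpace_eq_pred_add_one hn) hv
  set ι := (ℝ ∙ v)ᗮ.subtypeₗᵢ.comp e.toLinearIsometry with hιdef
  obtain ⟨hmeas, hint⟩ := hS.lintegral_encard_fiber hn hι
  -- On `v^⊥` the projection is the inverse of the isometry `e`, which preserves volume, so
  -- measurability and integral transfer from coordinates.
  have hcount : (fun u : (ℝ ∙ v)ᗮ => lineCount S v (u : EuclideanSpace ℝ (Fin n))) =
      fun u => (((chartProj ι ⁻¹' {e.symm u}) ∩ S).encard : ℝ≥0∞) := by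
    funext u
    have h1 : chartProj ι u = e.symm u := by
      rw [← chartProj_apply_self ι (e.symm u)]
      simp [hιdef]
    rw [lineCount_eq_encard_fiber hι, h1]
  refine ⟨hS.ae_isUnitNormalAt_iff hn, hS.aemeasurable_abs_inner_unitNormal hn hv, ?_, ?_⟩
  · rw [hcount]
    exact hmeas.comp_quasiMeasurePreserving e.symm.measurePreserving.quasiMeasurePreserving
  · rw [hcount, weightedProjectedArea, ← hint,
      e.symm.measurePreserving.lintegral_comp_emb e.symm.toMeasurableEquiv.measurableEmbedding
        (fun y => (((chartProj ι ⁻¹' {y}) ∩ S).encard : ℝ≥0∞))]
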